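/- **Setting.** Let $\mathbb X,\mathbb Y$ be finite-dimensional real normed spaces, let $\mathcal X\subseteq\mathbb X$, $\mathcal Y\subseteq\mathbb Y$ be nonempty, closed and convex, $\mathcal Y$ bounded, and let $r:\mathbb X\to\mathbb R\cup\{+\infty\}$, $g:\mathbb Y\to\mathbb R\cup\{+\infty\}$ be closed, convex, proper, and Lipschitz on $\mathcal X$, resp. $\mathcal Y$. Consider $$q^*=\inf_{x\in\mathcal X} q(x),\qquad q=f+r,\qquad f(x)=\max_{y\in\mathcal Y}\Phi(x,y)-g(y),\qquad q^*>-\infty .$$ Assume: for each $y\in\mathcal Y$, $\Phi(\cdot,y)$ is Fréchet differentiable on an open set $\mathcal X'\supseteq\mathcal X$, and on $\mathcal X\times\mathcal Y$ the gradient $\nabla_x\Phi$ is $L_{xx}$-Lipschitz in $x$ and $L_{xy}$-Lipschitz in $y$ ($L_{xy}\ge 0$); $\Phi$ is continuous on $\mathcal X\times\mathcal Y$; $\Phi(x,\cdot)$ is concave on $\mathcal Y$ for $x\in\mathcal X$; and for some $0<\gamma\le L_{xx}$, $\Phi(x',y)-\Phi(x,y)-\langle\nabla_x\Phi(x,y),x'-x\rangle\ge-\frac\gamma2\|x'-x\|^2$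 for $x,x'\in\mathcal X$, $y\in\mathcal Y$. A distance generating function (DGF) on a set $\mathcal U$ is an essentially smooth function that is finite, continuous and $1$-strongly convex on $\mathcal U$. Let $\omega_{\mathcal X},\omega_{\mathcal Y}$ be DGFs on $\mathcal X,\mathcal Y$, with $\omega_{\mathcal X}$ twice differentiable on $\mathcal X'$ and $\nabla\omega_{\mathcal X}$ $\beta_{\mathcal X}$-Lipschitz on $\mathcal X$, $\beta_{\mathcal X}\ge1$. Put $\mathcal X^o=\mathcal X\cap\operatorname{int}\operatorname{dom}\omega_{\mathcal X}$, $D(x',x)=\omega_{\mathcal X}(x')-\omega_{\mathcal X}(x)-\langle\nabla\omega_{\mathcal X}(x),x'-x\rangle$, and $\Omega=\sup_{\mathcal Y}|\omega_{\mathcal Y}|$, assumed positive. The primal oracle returns $\nabla_x\Phi(x,y)$ at a queried $(x,y)\in\mathcal X\times\mathcal Y$. **Parameters.** For $\varepsilon>0$ let $$\lambda=\tfrac1{2\gamma},\quad \eta=\tfrac{\varepsilon^2\lambda}{64\beta_{\mathcal X}^2},\quad \rho=\tfrac{\eta}{4\Omega},\quad \mu=\lambda^{-1}-\gamma=\gamma,\quad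 L'_\rho=L_{xx}+\lambda^{-1}\beta_{\mathcal X}+L_{xy}^2/\rho .$$ Let $f_\rho(x)=\max_{y\in\mathcal Y}\Phi(x,y)-g(y)-\rho\omega_{\mathcal Y}(y)$ and $Q^\lambda_\rho(x';x)=f_\rho(x')+r(x')+\lambda^{-1}D(x',x)$. Assume an oracle $\mathscr A$ that, for every $x\in\mathcal X$ and $\delta>0$, returns $\mathscr A(x,\delta)\in\mathcal Y$ maximizing $\Phi(x,\cdot)-g-\rho\omega_{\mathcal Y}$ over $\mathcal Y$ up to error $\delta$. **Outer algorithm (Algorithm 1).** From $x_1\in\mathcal X^o$, for $k=1,2,\dots$: (Step 2) find $x_{k+1}\in\mathcal X^o$ with $Q^\lambda_\rho(x_{k+1};x_k)\le\inf_{x'\in\mathcal X}Q^\lambda_\rho(x';x_k)+\eta$; stop and output $x_k$ when $\|x_{k+1}-x_k\|\le4\sqrt{\lambda\eta}$. **Inner method for Step 2 (Case I).** Fix $\delta$ with $0<\delta\le\delta_1=\dfrac{\eta\rho\mu^{3/2}}{(14\sqrt2)^2L_{xy}^2\sqrt{L'_\rho}\,(1+\sqrt{L'_\rho/\mu})^2}$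 ($\delta_1=+\infty$ if $L_{xy}=0$). Let $\tau=\sqrt{L'_\rho/\mu}$, $\alpha=\tau/(1+\tau)$, $\sigma=\sqrt{L'_\rho\mu}$. From $u^{-1}=u^0=\hat u^0\in\mathcal X^o$, iterate for $t\ge1$ $$\tilde u^t=u^{t-1}+\alpha(u^{t-1}-u^{t-2}),\qquad \hat u^t=\frac{\tilde u^t+\tau\hat u^{t-1}}{1+\tau},$$ $$G^t=\gamma\nabla\omega_{\mathcal X}(\hat u^t)+\nabla_x\Phi\big(\hat u^t,\mathscr A(\hat u^t,\delta)\big)-\lambda^{-1}\nabla\omega_{\mathcal X}(x_k),$$ $$u^t=\arg\min_{u\in\mathcal X}\; r(u)+\mu\omega_{\mathcal X}(u)+\langle G^t,u\rangle+\sigma D(u,u^{t-1}),$$ until the average $\bar u^t=\big(\sum_{i=1}^t\alpha^{-i}\big)^{-1}\sum_{i=1}^t\alpha^{-i}u^i$ satisfies the requirement of Step 2; then $x_{k+1}=\bar u^t$. Each inner iteration makes one primal oracle call. The starting points $u^0$ of the inner runs are arbitrary points of $\mathcal X^o$ such that, in outer iteration $k$, $u^0$ is within distance $R$ of one of $x_1,\dots,x_k$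 (for example $u^0=x_k$, or a fixed point). **Claim.** For every $\varepsilon>0$, from every proximal center $x_k\in\mathcal X^o$ and every start $u^0\in\mathcal X^o$ the inner method completes Step 2 after finitely many iterations; the outer algorithm stops after finitely many iterations; and its output $x_K$ is an $\varepsilon$-near-stationary point in the sense that $$\operatorname{prox}(q,x_K,\lambda)=\arg\min_{x'\in\mathcal X} q(x')+\lambda^{-1}D(x',x_K)$$ exists, is unique, and $\|x_K-\operatorname{prox}(q,x_K,\lambda)\|\le\varepsilon\lambda/\beta_{\mathcal X}$. The total number of primal oracle calls is $$O\big(\gamma(\sqrt{L_{xx}}+L_{xy})\,\varepsilon^{-3}\log(1/\varepsilon)\big)\qquad(\varepsilon\to0),$$ that is: there are a constant $C$, depending only on $\beta_{\mathcal X}$ and on upper bounds for $\Omega$ and $q(x_1)-q^*$, and a threshold $\varepsilon_0>0$, depending only on these and on $\gamma,L_{xx},L_{xy},R$, such that for $0<\varepsilon\le\varepsilon_0$ the number of calls is at most $C\,\gamma(\sqrt{L_{xx}}+L_{xy})\,\varepsilon^{-3}\log(1/\varepsilon)$. -/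

import Mathlib

open Set Filter Topology

noncomputable section

/-- A function `E → ℝ ∪ {+∞}`, given by its effective domain `dom` and its real values on `dom`;
the function is `+∞` outside `dom` (the numbers `val x` with `x ∉ dom` carry no meaning). -/
structure ExtFun (E : Type*) where
  dom : Set E
  val : E → ℝ

section General

variable {E : Type*} [NormedAddCommGroup E] [NormedSpace ℝ E]

/-- Closed (closed epigraph), convex and proper. -/
structure ExtFun.IsCCP (f : ExtFun E) : Prop where
  nonempty_dom : f.dom.Nonempty
  convex : ConvexOn ℝ f.dom f.val
  closed_epigraph : IsClosed {p : E × ℝ | p.1 ∈ f.dom ∧ f.val p.1 ≤ p.2}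

/-- `f` is finite and Lipschitz on `s`, with some finite constant. -/
def ExtFun.LipschitzOnSet (f : ExtFun E) (s : Set E) : Prop :=
  s ⊆ f.dom ∧ ∃ M : ℝ, ∀ x ∈ s, ∀ x' ∈ s, |f.val x - f.val x'| ≤ M * ‖x - x'‖

/-- Continuously differentiable on the nonempty interior of the domain, with gradients that blow up
at the boundary of the domain. -/
structure ExtFun.EssentiallySmooth (f : ExtFun E) : Prop where
  nonempty_interior : (interior f.dom).Nonempty
  contDiffOn : ContDiffOn ℝ 1 f.val (interior f.dom)
  blowup : ∀ u ∈ frontier f.dom,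
    Tendsto (fun v => ‖fderiv ℝ f.val v‖) (𝓝[interior f.dom] u) atTop

/-- Distance generating function on `U`. -/
structure ExtFun.IsDGF (ω : ExtFun E) (U : Set E) : Prop where
  subset_dom : U ⊆ ω.dom
  essentiallySmooth : ω.EssentiallySmooth
  continuousOn : ContinuousOn ω.val U
  strongConvexOn : StrongConvexOn U 1 ω.val

/-- Bregman divergence `D_ω(u', u)`. -/
def bregman (ω : ExtFun E) (u' u : E) : ℝ :=
  ω.val u' - ω.val u - fderiv ℝ ω.val u (u' - u)

/-- `U° = U ∩ int dom ω`. -/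
def relDom (ω : ExtFun E) (U : Set E) : Set E := U ∩ interior ω.dom

/-- A minimizer of `F` over `s` (chosen arbitrarily; a junk value if there is none). -/
def argminOn (F : E → ℝ) (s : Set E) : E :=
  Classical.epsilon fun u => u ∈ s ∧ IsMinOn F s u

/-! ### The inexact accelerated proximal gradient method -/

/-- `prev = u^{t-1}`, `cur = u^t`, `hat = û^t`; `calls` counts evaluations of the inexact gradient. -/
structure APGState (E : Type*) where
  prev : E
  cur : E
  hat : E
  calls : ℕ

/-- One iteration of the method for `min_U h + φ + μ ω`; `grad` is the inexact gradient of `h`. -/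
def apgStep (U : Set E) (φ ω : ExtFun E) (μ α τ η : ℝ) (grad : E → (E →L[ℝ] ℝ))
    (s : APGState E) : APGState E :=
  let tilde : E := α • (s.cur - s.prev) + s.cur
  let hat : E := (1 + τ)⁻¹ • (tilde + τ • s.hat)
  let G : E →L[ℝ] ℝ := grad hat
  { prev := s.cur
    cur := argminOn (fun u => φ.val u + μ * ω.val u + G u + η * bregman ω u s.cur) U
    hat := hat
    calls := s.calls + 1 }

/-- State after `t` iterations from `u^{-1} = û^0 = u^0`. -/
def apgState (U : Set E) (φ ω : ExtFun E) (μ α τ η : ℝ) (grad : E → (E →L[ℝ] ℝ)) (u0 : E) :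
    ℕ → APGState E
  | 0 => ⟨u0, u0, u0, 0⟩
  | t + 1 => apgStep U φ ω μ α τ η grad (apgState U φ ω μ α τ η grad u0 t)

/-- Weighted average `(∑_{t=1}^k θ_t)⁻¹ ∑_{t=1}^k θ_t u^t`. -/
def weightedAverage (θ : ℕ → ℝ) (u : ℕ → E) (k : ℕ) : E :=
  (∑ t ∈ Finset.Icc 1 k, θ t)⁻¹ • ∑ t ∈ Finset.Icc 1 k, θ t • u t

end General

/-! ### The minimax problem -/

/-- Data of `min_{x ∈ 𝒳} max_{y ∈ 𝒴} Φ(x,y) - g(y) + r(x)`, with distance generating functions.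
`nbhd` is the open set containing `𝒳` on which `Φ(·,y)` and `ωX` are differentiable. Only the values
of `Φ` on `nbhd × 𝒴` matter, and these are finite. -/
structure MinimaxProblem (X Y : Type*) where
  𝒳 : Set X
  nbhd : Set X
  𝒴 : Set Y
  Φ : X → Y → ℝ
  r : ExtFun X
  g : ExtFun Y
  ωX : ExtFun X
  ωY : ExtFun Y

/-- `γ`: weak convexity; `Lxx`, `Lxy`: Lipschitz constants of `∇ₓΦ` in `x` and in `y`;
`β`: Lipschitz constant of `∇ωX`. -/
structure Constants where
  γ : ℝ
  Lxx : ℝ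
  Lxy : ℝ
  β : ℝ

namespace Constants

variable (c : Constants)

/-- Primal smoothing parameter `λ = 1/(2γ)`. -/
def lam : ℝ := 1 / (2 * c.γ)

/-- Accuracy parameter `η = ε² λ / (64 β²)`. -/
def acc (ε : ℝ) : ℝ := ε ^ 2 * c.lam / (64 * c.β ^ 2)

/-- `μ = λ⁻¹ - γ`. -/
def mu : ℝ := c.lam⁻¹ - c.γ

/-- `L'_ρ = L'_xx + L_xy² / ρ` with `L'_xx = L_xx + λ⁻¹ β`. -/
def Lrho (ρ : ℝ) : ℝ := (c.Lxx + c.lam⁻¹ * c.β) + c.Lxy ^ 2 / ρ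

/-- The stopping test of the outer loop in iteration `k`: `‖x_{k+1} - x_k‖ ≤ 4 √(λη)`. -/
def Stops {X : Type*} [NormedAddCommGroup X] (ε : ℝ) (x : ℕ → X) (k : ℕ) : Prop :=
  ‖x (k + 1) - x k‖ ≤ 4 * √(c.lam * c.acc ε)

end Constants

namespace MinimaxProblem

variable {X Y : Type*} [NormedAddCommGroup X] [NormedSpace ℝ X]
  [NormedAddCommGroup Y] [NormedSpace ℝ Y]

variable (P : MinimaxProblem X Y)

/-- The primal first-order oracle, `(x, y) ↦ ∇ₓΦ(x,y)`. -/
def primalOracle (x : X) (y : Y) : X →L[ℝ] ℝ := fderiv ℝ (fun x' => P.Φ x' y) x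

/-- `f(x) = max_{y ∈ 𝒴} Φ(x,y) - g(y)`. -/
def f (x : X) : ℝ := sSup ((fun y => P.Φ x y - P.g.val y) '' P.𝒴)

/-- `q = f + r`. -/
def q (x : X) : ℝ := P.f x + P.r.val x

/-- `q^* = inf_𝒳 q`. -/
def qStar : ℝ := sInf (P.q '' P.𝒳)

/-- The smoothed inner objective `Φ(x,y) - g(y) - ρ ωY(y)`. -/
def phiD (ρ : ℝ) (x : X) (y : Y) : ℝ := P.Φ x y - P.g.val y - ρ * P.ωY.val y

/-- `f_ρ(x) = max_{y ∈ 𝒴} Φ(x,y) - g(y) - ρ ωY(y)`. -/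
def fSmooth (ρ : ℝ) (x : X) : ℝ := sSup (P.phiD ρ x '' P.𝒴)

/-- `Q^λ(x'; x) = q(x') + λ⁻¹ D(x', x)`. -/
def Q (l : ℝ) (x' x : X) : ℝ := P.q x' + l⁻¹ * bregman P.ωX x' x

/-- `Q_ρ^λ(x'; x) = f_ρ(x') + r(x') + λ⁻¹ D(x', x)`. -/
def QSmooth (ρ l : ℝ) (x' x : X) : ℝ :=
  P.fSmooth ρ x' + P.r.val x' + l⁻¹ * bregman P.ωX x' x

/-- `q_ρ^λ(x) = inf_{x' ∈ 𝒳} Q_ρ^λ(x'; x)`. -/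
def envSmooth (ρ l : ℝ) (x : X) : ℝ := sInf ((fun x' => P.QSmooth ρ l x' x) '' P.𝒳)

/-- `Ω = sup_{y ∈ 𝒴} |ωY(y)|`. -/
def Omega : ℝ := sSup ((fun y => |P.ωY.val y|) '' P.𝒴)

/-- `p = prox(q, x, λ)`, i.e. `p` minimizes `Q^λ(·; x)` over `𝒳`. -/
def IsProx (l : ℝ) (x p : X) : Prop := p ∈ P.𝒳 ∧ IsMinOn (fun x' => P.Q l x' x) P.𝒳 p

/-- `x` is `ε`-near-stationary (with parameter `λ`): `prox(q,x,λ)` is well defined and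
`‖x - prox(q,x,λ)‖ ≤ ε λ / β`. -/
def IsNearStationary (β ε l : ℝ) (x : X) : Prop :=
  x ∈ P.𝒳 ∧ (∃! p, P.IsProx l x p) ∧ ∀ p, P.IsProx l x p → ‖x - p‖ ≤ ε * l / β

/-- The standing assumptions. -/
structure Assumptions (c : Constants) : Prop where
  nonempty_𝒳 : P.𝒳.Nonempty
  closed_𝒳 : IsClosed P.𝒳
  convex_𝒳 : Convex ℝ P.𝒳
  nonempty_𝒴 : P.𝒴.Nonempty
  closed_𝒴 : IsClosed P.𝒴
  convex_𝒴 : Convex ℝ P.𝒴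
  bounded_𝒴 : Bornology.IsBounded P.𝒴
  ccp_r : P.r.IsCCP
  lipschitz_r : P.r.LipschitzOnSet P.𝒳
  ccp_g : P.g.IsCCP
  lipschitz_g : P.g.LipschitzOnSet P.𝒴
  bddBelow_q : BddBelow (P.q '' P.𝒳)
  -- smoothness of `Φ(·,y)`
  open_nbhd : IsOpen P.nbhd
  subset_nbhd : P.𝒳 ⊆ P.nbhd
  differentiable_Φ : ∀ y ∈ P.𝒴, DifferentiableOn ℝ (fun x => P.Φ x y) P.nbhd
  Lxx_bound : ∀ x ∈ P.𝒳, ∀ x' ∈ P.𝒳, ∀ y ∈ P.𝒴,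
    ‖P.primalOracle x y - P.primalOracle x' y‖ ≤ c.Lxx * ‖x - x'‖
  Lxy_nonneg : 0 ≤ c.Lxy
  Lxy_bound : ∀ x ∈ P.𝒳, ∀ y ∈ P.𝒴, ∀ y' ∈ P.𝒴,
    ‖P.primalOracle x y - P.primalOracle x y'‖ ≤ c.Lxy * ‖y - y'‖
  -- joint continuity
  continuous_Φ : ContinuousOn (fun p : X × Y => P.Φ p.1 p.2) (P.𝒳 ×ˢ P.𝒴)
  -- weak convexity of `Φ(·,y)`
  γ_pos : 0 < c.γ
  γ_le : c.γ ≤ c.Lxx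
  weakConvex_Φ : ∀ y ∈ P.𝒴, ∀ x ∈ P.𝒳, ∀ x' ∈ P.𝒳,
    -(c.γ / 2) * ‖x' - x‖ ^ 2 ≤ P.Φ x' y - P.Φ x y - P.primalOracle x y (x' - x)
  -- concavity of `Φ(x,·)`
  concave_Φ : ∀ x ∈ P.𝒳, ConcaveOn ℝ P.𝒴 (P.Φ x)
  -- distance generating functions
  dgf_X : P.ωX.IsDGF P.𝒳
  nbhd_subset_dom : P.nbhd ⊆ P.ωX.dom
  differentiable_ωX : DifferentiableOn ℝ P.ωX.val P.nbhd
  differentiable_fderiv_ωX : DifferentiableOn ℝ (fderiv ℝ P.ωX.val) P.nbhd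
  one_le_β : 1 ≤ c.β
  β_bound : ∀ x ∈ P.𝒳, ∀ x' ∈ P.𝒳,
    ‖fderiv ℝ P.ωX.val x - fderiv ℝ P.ωX.val x'‖ ≤ c.β * ‖x - x'‖
  dgf_Y : P.ωY.IsDGF P.𝒴
  Omega_pos : 0 < P.Omega

/-- `A` solves the smoothed inner maximization at every `x ∈ 𝒳` to every accuracy `δ > 0`. (Adding to
`Φ` a function of `x` alone, as the proximal subproblems do, does not change this condition.) -/
def IsDualOracle (ρ : ℝ) (A : X → ℝ → Y) : Prop :=
  ∀ x ∈ P.𝒳, ∀ δ > 0, A x δ ∈ P.𝒴 ∧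
    sSup (P.phiD ρ x '' P.𝒴) - P.phiD ρ x (A x δ) ≤ δ

variable (c : Constants) (ε : ℝ)

/-- Dual smoothing parameter `ρ = η / (4Ω)`. -/
def rho : ℝ := c.acc ε / (4 * P.Omega)

/-- Admissible accuracy for the calls to the dual oracle:
`0 < δ ≤ η ρ μ^{3/2} / ((14√2)² L_xy² (L'_ρ)^{1/2} (1 + (L'_ρ/μ)^{1/2})²)`, where the right-hand side
is read as `+∞` if `L_xy = 0`. -/
def IsOracleAccuracy (δ : ℝ) : Prop :=
  0 < δ ∧
  δ * ((14 * √2) ^ 2 * c.Lxy ^ 2 * √(c.Lrho (P.rho c ε)) *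
      (1 + √(c.Lrho (P.rho c ε) / c.mu)) ^ 2) ≤
    c.acc ε * P.rho c ε * c.mu ^ (3 / 2 : ℝ)

/-- Inexact gradient at `x` of `h(x) = max_{y ∈ 𝒴} Ψ(x,y) - g(y) - ρ ωY(y)`, where
`Ψ(x,y) = γ ωX(x) + Φ(x,y) - λ⁻¹ ⟨∇ωX(z), x⟩` and `z` is the current proximal center (so that
`h + r + μ ωX` is `Q_ρ^λ(·; z)` up to a constant): the gradient `∇ₓΨ(x, A(x, δ))`.
It makes exactly one call to the primal oracle. -/
def inexactGrad (A : X → ℝ → Y) (δ : ℝ) (z x : X) : X →L[ℝ] ℝ :=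
  c.γ • fderiv ℝ P.ωX.val x + P.primalOracle x (A x δ) - c.lam⁻¹ • fderiv ℝ P.ωX.val z

/-- State of the method for the subproblem with proximal center `z`, started at `u0`, after `t`
iterations; `τ = (L'_ρ/μ)^{1/2}`, `α = τ/(1+τ)`, step parameter `(L'_ρ μ)^{1/2}`. -/
def innerState (A : X → ℝ → Y) (δ : ℝ) (z u0 : X) (t : ℕ) : APGState X :=
  let L := c.Lrho (P.rho c ε)
  let τ := √(L / c.mu)
  apgState P.𝒳 P.r P.ωX c.mu (τ / (1 + τ)) τ (√(L * c.mu)) (P.inexactGrad c A δ z) u0 t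

/-- Output of the method after `k` iterations: the average with weights `θ_t = α^{-t}`. -/
def innerOutput (A : X → ℝ → Y) (δ : ℝ) (z u0 : X) (k : ℕ) : X :=
  let τ := √(c.Lrho (P.rho c ε) / c.mu)
  weightedAverage (fun t => ((τ / (1 + τ)) ^ t)⁻¹) (fun t => (P.innerState c ε A δ z u0 t).cur) k

/-- `x⁺` is acceptable in Step 2 from the center `z`: `x⁺ ∈ 𝒳°` and
`Q_ρ^λ(x⁺; z) ≤ q_ρ^λ(z) + η`. -/
def StepTwo (z xp : X) : Prop :=
  xp ∈ relDom P.ωX P.𝒳 ∧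
  P.QSmooth (P.rho c ε) c.lam xp z ≤ P.envSmooth (P.rho c ε) c.lam z + c.acc ε

/-- `n ≥ 1` is the first iteration whose output is acceptable in Step 2. -/
def IsStepTwoCount (A : X → ℝ → Y) (δ : ℝ) (z u0 : X) (n : ℕ) : Prop :=
  1 ≤ n ∧ P.StepTwo c ε z (P.innerOutput c ε A δ z u0 n) ∧
  ∀ t, 1 ≤ t → t < n → ¬ P.StepTwo c ε z (P.innerOutput c ε A δ z u0 t)

/-- The outer iterates `x 1, x 2, …` (the stopping test left aside): for `k ≥ 1`, Step 2 in iteration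
`k` runs the inner method from `u k`, for `N k` iterations, and yields `x (k+1)`. The inner starting
points are arbitrary points of `𝒳°` within distance `R` of an outer iterate found so far. -/
structure IsRun (A : X → ℝ → Y) (δ R : ℝ) (x u : ℕ → X) (N : ℕ → ℕ) : Prop where
  init : x 1 ∈ relDom P.ωX P.𝒳
  start_mem : ∀ k, 1 ≤ k → u k ∈ relDom P.ωX P.𝒳
  start_near : ∀ k, 1 ≤ k → ∃ j, 1 ≤ j ∧ j ≤ k ∧ ‖u k - x j‖ ≤ R
  count : ∀ k, 1 ≤ k → P.IsStepTwoCount c ε A δ (x k) (u k) (N k)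
  next : ∀ k, 1 ≤ k → x (k + 1) = P.innerOutput c ε A δ (x k) (u k) (N k)

/-- Number of primal oracle calls in the outer iterations `1, …, K`. -/
def totalCalls (A : X → ℝ → Y) (δ : ℝ) (x u : ℕ → X) (N : ℕ → ℕ) (K : ℕ) : ℕ :=
  ∑ k ∈ Finset.Icc 1 K, (P.innerState c ε A δ (x k) (u k) (N k)).calls

end MinimaxProblem

end

noncomputable section

/-! ### Strong convexity, quadratic bounds and existence of minimizers in a normed space -/

section ConvexAnalysis

variable {E : Type*} [NormedAddCommGroup E] [NormedSpace ℝ E]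

/-! Outer loop. Since `λ⁻¹ = 2γ` and `Φ(·,y)` is `γ`-weakly convex, the proximal objectives are
`γ`-strongly convex, both for `q` and for its smoothing (`strongConvexOn_QSmooth`). Accepting a step
within `η` of optimal and comparing with the center `z` gives `γ‖x⁺ - z‖² ≤` (decrease of the
smoothed objective) `+ η`. A step that does not trigger the stopping test is longer than `4√(λη)`,
so it decreases the objective by at least `7η`; hence at most `2 + Δ/(7η)` outer iterations occur.
When the test triggers, `x⁺` is close to the center and, by strong convexity and `|f_ρ - f| ≤ η/4`,
also close to the true proximal point.

Inner loop. Half of the Bregman term convexifies `f_ρ`, the other half is the strongly convex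
regularizer `μω`. The function `f_ρ` is never differentiated: the slope `∇ₓΦ(x, y(x))`, with `y(x)`
the exact dual maximizer, gives a quadratic lower bound (`fSmooth_minorant`) and an upper bound of
curvature `Lxx + Lxy²/ρ` (`fSmooth_majorant`), and these two bounds suffice for acceleration. An
inexact dual answer perturbs the slope by `e = Lxy √(2δ/ρ)`. The potential argument (`step_le`,
`potential_le`) then carries an error `e` times the averaged distance to the minimizer. As `𝒳` may
be unbounded, this distance has no a priori bound; the potential itself controls its square, and
`expAvg_le_of_sq_le` solves the resulting self-referential inequality. This yields accuracy `η`
after `4(1 + √(L/μ)) log(…)` iterations (`gap_le`, `apg_gap_le`).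

Counting. The number of outer iterations is of order `γ ε⁻²`; since `ρ` is of order `ε²`, `√(L/μ)`
is at most of order `(√Lxx + Lxy)/ε`; the starting distances enter only through a logarithm, so the
crude bound `run_dist_le` is enough. -/

theorem nonneg_of_forall_mul_add_sq_mul {a b : ℝ}
    (h : ∀ s : ℝ, 0 < s → s ≤ 1 → 0 ≤ s * a + s ^ 2 * b) : 0 ≤ a := by
  by_contra! ha
  have hb : 0 < 2 * (|b| + 1) := by positivity
  obtain ⟨s, hs0, hs1, hs⟩ : ∃ s : ℝ, 0 < s ∧ s ≤ 1 ∧ s * (2 * (|b| + 1)) ≤ -a :=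
    -- For this `s` the second-order term is at most half of `s|a|`, so the sum is negative. This
    -- replaces dividing by `s` and passing to the limit.
    ⟨min 1 (-a / (2 * (|b| + 1))), lt_min one_pos (div_pos (neg_pos.2 ha) hb), min_le_left _ _,
      (le_div_iff₀ hb).1 (min_le_right _ _)⟩
  have h1 := h s hs0 hs1
  have h2 : 0 ≤ a + s * b := nonneg_of_mul_nonneg_right (a := s) (by linarith [h1]) hs0
  have h3 : s * b ≤ s * |b| := mul_le_mul_of_nonneg_left (le_abs_self b) hs0.le
  linarith

theorem StrongConvexOn.add_sq_le_of_isMinOn {s : Set E} {m : ℝ} {F : E → ℝ}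
    (hF : StrongConvexOn s m F) {p x : E} (hp : p ∈ s) (hmin : IsMinOn F s p) (hx : x ∈ s) :
    F p + m / 2 * ‖x - p‖ ^ 2 ≤ F x := by
  suffices 0 ≤ F x - F p - m / 2 * ‖x - p‖ ^ 2 by linarith
  refine nonneg_of_forall_mul_add_sq_mul (b := m / 2 * ‖x - p‖ ^ 2) fun t ht ht1 => ?_
  have h := hF.2 hx hp ht.le (sub_nonneg.2 ht1) (by ring)
  have h2 := hmin (hF.1 hx hp ht.le (sub_nonneg.2 ht1) (by ring))
  simp only [smul_eq_mul, mem_ofPred_eq] at h h2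
  linarith

/-- Use the minorant at the convex combination itself, evaluated at both endpoints: the linear terms
cancel, and `ab² + ba² = ab`. No inner product structure is needed. -/
theorem strongConvexOn_of_forall_exists_affine_minorant {s : Set E} (hs : Convex ℝ s) {m : ℝ}
    {F : E → ℝ} (h : ∀ x ∈ s, ∃ l : E →L[ℝ] ℝ, ∀ x' ∈ s,
      F x + l (x' - x) + m / 2 * ‖x' - x‖ ^ 2 ≤ F x') : StrongConvexOn s m F := by
  refine ⟨hs, fun x hx y hy a b ha hb hab => ?_⟩
  obtain ⟨l, hl⟩ := h _ (hs hx hy ha hb hab)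
  have e1 : x - (a • x + b • y) = b • (x - y) := by
    rw [eq_sub_of_add_eq hab]; module
  have e2 : y - (a • x + b • y) = (-a) • (x - y) := by
    rw [eq_sub_of_add_eq' hab]; module
  have h1 := hl x hx
  have h2 := hl y hy
  rw [e1, map_smul, norm_smul, Real.norm_of_nonneg hb, smul_eq_mul] at h1
  rw [e2, map_smul, norm_smul, norm_neg, Real.norm_of_nonneg ha, smul_eq_mul] at h2
  simp only [smul_eq_mul]
  have h3 := add_le_add (mul_le_mul_of_nonneg_left h1 ha) (mul_le_mul_of_nonneg_left h2 hb)
  have hb' : b = 1 - a := by linarith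
  subst hb'
  nlinarith [h3]

/-- The descent lemma, by comparing derivatives along the segment with those of a quadratic, so that
nothing has to be integrated. -/
theorem le_add_fderiv_add_sq_of_lipschitz {s : Set E} (hs : Convex ℝ s) {F : E → ℝ} {L : ℝ}
    (hd : ∀ x ∈ s, DifferentiableAt ℝ F x)
    (hL : ∀ x ∈ s, ∀ x' ∈ s, ‖fderiv ℝ F x - fderiv ℝ F x'‖ ≤ L * ‖x - x'‖)
    {x x' : E} (hx : x ∈ s) (hx' : x' ∈ s) :
    F x' ≤ F x + fderiv ℝ F x (x' - x) + L / 2 * ‖x' - x‖ ^ 2 := by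
  set d := x' - x
  have hmem : ∀ t ∈ Icc (0 : ℝ) 1, x + t • d ∈ s := fun t ht =>
    hs.add_smul_sub_mem hx hx' ht
  have hder : ∀ t ∈ Icc (0 : ℝ) 1,
      HasDerivAt (fun t : ℝ => F (x + t • d)) (fderiv ℝ F (x + t • d) d) t := fun t ht => by
    have h1 : HasDerivAt (fun t : ℝ => x + t • d) d t := by
      simpa using ((hasDerivAt_id t).smul_const d).const_add x
    exact (hd _ (hmem t ht)).hasFDerivAt.comp_hasDerivAt t h1
  have hB : ∀ t : ℝ, HasDerivAt
      (fun t : ℝ => F x + t * fderiv ℝ F x d + L / 2 * ‖d‖ ^ 2 * t ^ 2)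
      (fderiv ℝ F x d + L * ‖d‖ ^ 2 * t) t := fun t => by
    have h1 := ((hasDerivAt_id t).mul_const (fderiv ℝ F x d)).const_add (F x)
    have h2 := ((hasDerivAt_pow 2 t).const_mul (L / 2 * ‖d‖ ^ 2))
    refine (h1.add h2).congr_deriv ?_
    simp only [Nat.cast_ofNat, Nat.add_one_sub_one, pow_one, one_mul]
    ring
  have := image_le_of_deriv_right_le_deriv_boundary (f := fun t : ℝ => F (x + t • d))
    (a := 0) (b := 1) (fun t ht => (hder t ht).continuousAt.continuousWithinAt)
    (fun t ht => (hder t (Ico_subset_Icc_self ht)).hasDerivWithinAt)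
    (B := fun t : ℝ => F x + t * fderiv ℝ F x d + L / 2 * ‖d‖ ^ 2 * t ^ 2)
    (by simp) (fun t _ => (hB t).continuousAt.continuousWithinAt)
    (fun t _ => (hB t).hasDerivWithinAt) (fun t ht => ?_) (right_mem_Icc.2 zero_le_one)
  · have e : x + (1 : ℝ) • d = x' := by simp [d]
    simp only [e] at this
    linarith
  · have h1 := hL _ (hmem t (Ico_subset_Icc_self ht)) x hx
    have h2 := (le_abs_self _).trans
      ((fderiv ℝ F (x + t • d) - fderiv ℝ F x).le_opNorm d)
    rw [add_sub_cancel_left, norm_smul, Real.norm_of_nonneg ht.1] at h1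
    have h3 := h2.trans (mul_le_mul_of_nonneg_right h1 (norm_nonneg d))
    rw [sub_apply] at h3
    nlinarith [h3]

theorem StrongConvexOn.add_fderiv_add_sq_le {s : Set E} {m : ℝ} {F : E → ℝ}
    (hF : StrongConvexOn s m F) {x x' : E} (hx : x ∈ s) (hx' : x' ∈ s)
    (hd : DifferentiableAt ℝ F x) :
    F x + fderiv ℝ F x (x' - x) + m / 2 * ‖x' - x‖ ^ 2 ≤ F x' := by
  set d := x' - x with hd_def
  have hder : HasDerivAt (fun t : ℝ => F (x + t • d)) (fderiv ℝ F x d) 0 := by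
    have h1 : HasDerivAt (fun t : ℝ => x + t • d) d 0 := by
      simpa using ((hasDerivAt_id (0 : ℝ)).smul_const d).const_add x
    have h2 : HasFDerivAt F (fderiv ℝ F x) (x + (0 : ℝ) • d) := by simpa using hd.hasFDerivAt
    exact h2.comp_hasDerivAt 0 h1
  have hlim := hder.tendsto_slope_zero_right
  have hlim2 : Tendsto (fun t : ℝ => F x' - F x - (1 - t) * (m / 2 * ‖d‖ ^ 2)) (𝓝[>] 0)
      (𝓝 (F x' - F x - (1 - 0) * (m / 2 * ‖d‖ ^ 2))) :=
    tendsto_nhdsWithin_of_tendsto_nhds (Continuous.tendsto (by fun_prop) 0)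
  have hle : fderiv ℝ F x d ≤ F x' - F x - (1 - 0) * (m / 2 * ‖d‖ ^ 2) := by
    refine le_of_tendsto_of_tendsto hlim hlim2 ?_
    filter_upwards [Ioo_mem_nhdsGT (zero_lt_one' ℝ)] with t ht
    have h := hF.2 hx' hx ht.1.le (sub_nonneg.2 ht.2.le) (by ring)
    have e : t • x' + (1 - t) • x = x + t • d := by rw [hd_def]; module
    simp only [e, smul_eq_mul, ← hd_def] at h
    simp only [zero_add, zero_smul, add_zero, smul_eq_mul]
    rw [inv_mul_le_iff₀ ht.1]
    linarith
  linarith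

/-- The minorant touches `F` at its base point and is continuous, so `F` is lower semicontinuous
there. One such minorant also forces `F > F x₀` outside a ball of radius `2M/m`, which reduces the
problem to a compact set. -/
theorem exists_isMinOn_of_quadratic_minorant [FiniteDimensional ℝ E] {s : Set E}
    (hs : IsClosed s) (hne : s.Nonempty) {F : E → ℝ} {m : ℝ} (hm : 0 < m)
    (h : ∀ x ∈ s, ∃ M : ℝ, ∀ x' ∈ s, F x - M * ‖x' - x‖ + m / 2 * ‖x' - x‖ ^ 2 ≤ F x') :
    ∃ p ∈ s, IsMinOn F s p := by
  obtain ⟨x₀, hx₀⟩ := hne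
  obtain ⟨M, hM⟩ := h x₀ hx₀
  set ρ : ℝ := max 0 (2 * M / m)
  have : ProperSpace E := FiniteDimensional.proper ℝ E
  have hK : IsCompact (s ∩ Metric.closedBall x₀ ρ) :=
    (isCompact_closedBall x₀ ρ).inter_left hs
  have hlsc : LowerSemicontinuousOn F (s ∩ Metric.closedBall x₀ ρ) := by
    intro x hx y hy
    obtain ⟨M', hM'⟩ := h x hx.1
    have hc : ContinuousAt (fun x' => F x - M' * ‖x' - x‖ + m / 2 * ‖x' - x‖ ^ 2) x := by
      fun_prop
    have hev : ∀ᶠ x' in 𝓝 x, y < F x - M' * ‖x' - x‖ + m / 2 * ‖x' - x‖ ^ 2 :=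
      hc.eventually (lt_mem_nhds (by simpa using hy))
    filter_upwards [nhdsWithin_le_nhds hev, self_mem_nhdsWithin] with x' h1 h2
    exact h1.trans_le (hM' x' h2.1)
  have hx₀K : x₀ ∈ s ∩ Metric.closedBall x₀ ρ :=
    ⟨hx₀, Metric.mem_closedBall_self (le_max_left _ _)⟩
  obtain ⟨p, hp, hmin⟩ := LowerSemicontinuousOn.exists_isMinOn ⟨x₀, hx₀K⟩ hK hlsc
  refine ⟨p, hp.1, fun x hx => ?_⟩
  by_cases hxK : x ∈ Metric.closedBall x₀ ρ
  · exact hmin ⟨hx, hxK⟩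
  · have h1 : F p ≤ F x₀ := hmin hx₀K
    have h2 := hM x hx
    rw [mem_closedBall_iff_norm, not_le] at hxK
    have h3 : 2 * M < m * ‖x - x₀‖ := by
      rw [mul_comm m, ← div_lt_iff₀ hm]; exact (le_max_right _ _).trans_lt hxK
    have h4 : 0 ≤ ‖x - x₀‖ := norm_nonneg _
    show F p ≤ F x
    nlinarith

theorem bregman_self (ω : ExtFun E) (x : E) : bregman ω x x = 0 := by simp [bregman]

end ConvexAnalysis

/-! ### Exponentially weighted averages -/

section ExpAvg

variable {E : Type*} [NormedAddCommGroup E] [NormedSpace ℝ E]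

/-- The unnormalized exponentially weighted average `(1-α) ∑_{i=1}^t α^{t-i} z_i`. -/
def expAvg (α : ℝ) (z : ℕ → E) : ℕ → E
  | 0 => 0
  | t + 1 => α • expAvg α z t + (1 - α) • z (t + 1)

theorem expAvg_eq_sum {α : ℝ} (hα : α ≠ 0) (z : ℕ → E) (t : ℕ) :
    expAvg α z t = ((1 - α) * α ^ t) • ∑ i ∈ Finset.Icc 1 t, (α ^ i)⁻¹ • z i := by
  induction t with
  | zero => simp [expAvg]
  | succ t ih =>
    rw [expAvg, ih, Finset.sum_Icc_succ_top (by omega), smul_add, smul_smul, smul_smul]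
    congr 2
    · ring
    · field_simp

theorem expAvg_one {α : ℝ} (t : ℕ) : expAvg α (fun _ => (1 : ℝ)) t = 1 - α ^ t := by
  induction t with
  | zero => simp [expAvg]
  | succ t ih => rw [expAvg, ih]; simp only [smul_eq_mul]; ring

/-- The weights add up to `1 - α^t`; the missing mass `α^t` is what the running average `w` places
on the starting point. -/
theorem expAvg_eq_smul_weightedAverage {α : ℝ} (hα : 0 < α) (z : ℕ → E) (t : ℕ) :
    expAvg α z t = (1 - α ^ t) • weightedAverage (fun i => (α ^ i)⁻¹) z t := by
  rcases Nat.eq_zero_or_pos t with rfl | ht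
  · simp [expAvg]
  have h1 := expAvg_eq_sum hα.ne' (fun _ => (1 : ℝ)) t
  rw [expAvg_one] at h1
  simp only [smul_eq_mul, mul_one] at h1
  have hS : 0 < ∑ i ∈ Finset.Icc 1 t, (α ^ i)⁻¹ :=
    Finset.sum_pos (fun i _ => by positivity) ⟨1, Finset.mem_Icc.2 ⟨le_rfl, ht⟩⟩
  rw [expAvg_eq_sum hα.ne', weightedAverage, smul_smul, h1, mul_assoc _ _ (_)⁻¹,
    mul_inv_cancel₀ hS.ne', mul_one]

theorem sum_inv_pow_pos {α : ℝ} (hα : 0 < α) {t : ℕ} (ht : 1 ≤ t) :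
    0 < ∑ i ∈ Finset.Icc 1 t, (α ^ i)⁻¹ :=
  Finset.sum_pos (fun i _ => by positivity) ⟨1, Finset.mem_Icc.2 ⟨le_rfl, ht⟩⟩

theorem weightedAverage_mem {U : Set E} (hU : Convex ℝ U) {α : ℝ} (hα : 0 < α) {u : ℕ → E}
    (hu : ∀ t, u t ∈ U) {t : ℕ} (ht : 1 ≤ t) :
    weightedAverage (fun i => (α ^ i)⁻¹) u t ∈ U :=
  hU.centerMass_mem (fun i _ => by positivity) (sum_inv_pow_pos hα ht) fun i _ => hu i

theorem ConvexOn.map_weightedAverage_le {U : Set E} {φ : E → ℝ} (hφ : ConvexOn ℝ U φ) {α : ℝ}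
    (hα : 0 < α) (hα1 : α < 1) {u : ℕ → E} (hu : ∀ t, u t ∈ U) {t : ℕ} (ht : 1 ≤ t) :
    (1 - α ^ t) * φ (weightedAverage (fun i => (α ^ i)⁻¹) u t) ≤ expAvg α (φ ∘ u) t := by
  rw [expAvg_eq_smul_weightedAverage hα]
  exact mul_le_mul_of_nonneg_left
    (hφ.map_centerMass_le (fun i _ => by positivity) (sum_inv_pow_pos hα ht) fun i _ => hu i)
    (sub_nonneg.2 (pow_le_one₀ hα.le hα1.le))

theorem expAvg_nonneg {α : ℝ} (hα : 0 < α) (hα1 : α < 1) {a : ℕ → ℝ} (ha : ∀ t, 0 ≤ a t) (t : ℕ) :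
    0 ≤ expAvg α a t := by
  induction t with
  | zero => simp [expAvg]
  | succ t ih =>
    exact add_nonneg (mul_nonneg hα.le ih) (mul_nonneg (sub_nonneg.2 hα1.le) (ha _))

/-- A sequence whose squares are controlled by its own exponentially weighted average, scaled by a
small factor `e`, has an average of order `e` up to a geometrically decaying term. -/
theorem expAvg_le_of_sq_le {α μ e C : ℝ} (hα : 0 < α) (hα1 : α < 1) (hμ : 0 < μ) (he : 0 ≤ e)
    (hC : 0 ≤ C) {a : ℕ → ℝ} (ha : ∀ t, 0 ≤ a t)
    (h : ∀ t, 1 ≤ t → μ / 2 * a t ^ 2 ≤ α ^ t * C + e * expAvg α a t) (t : ℕ) :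
    expAvg α a t ≤ 2 * e / μ + 4 * √(2 * C / μ) * ((3 + α) / 4) ^ t := by
  set A := √(2 * C / μ)
  -- This rate satisfies `1 - q = (1 - α)/4`, `α ≤ q²`, and `8α + 2(1-α)q ≤ 4(1+α)q`, which closes
  -- the induction below.
  set q := (3 + α) / 4 with hq_def
  have hA : 0 ≤ A := Real.sqrt_nonneg _
  have hA2 : A ^ 2 = 2 * C / μ := Real.sq_sqrt (by positivity)
  have hq : 0 < q := by positivity
  have hqα : α ≤ q ^ 2 := by rw [hq_def]; nlinarith
  have key : ∀ t, 1 ≤ t → a t ≤ A * q ^ t + expAvg α a t / 2 + e / μ := fun t ht => by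
    have hb := expAvg_nonneg hα hα1 ha t
    have hx : 0 ≤ A * q ^ t := by positivity
    have hy : 0 ≤ expAvg α a t / 2 + e / μ := by positivity
    refine le_of_sq_le_sq ?_ (by positivity)
    have h1 : α ^ t ≤ (q ^ t) ^ 2 := by
      rw [← pow_mul, mul_comm, pow_mul]; exact pow_le_pow_left₀ hα.le hqα t
    have h2 : a t ^ 2 ≤ 2 / μ * (α ^ t * C + e * expAvg α a t) := by
      have := h t ht
      rw [div_mul_eq_mul_div, le_div_iff₀ hμ]; linarith
    have h3 : 2 / μ * (α ^ t * C) ≤ (A * q ^ t) ^ 2 := by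
      rw [mul_pow, hA2]
      have := mul_le_mul_of_nonneg_left h1 (show 0 ≤ 2 * C / μ by positivity)
      calc _ = 2 * C / μ * α ^ t := by ring
        _ ≤ _ := this
    -- Arithmetic-geometric mean: the square root of the error term splits into half of the average,
    -- to be absorbed on the left, plus `e/μ`.
    have h4 : 2 / μ * (e * expAvg α a t) ≤ (expAvg α a t / 2 + e / μ) ^ 2 := by
      have := sq_nonneg (expAvg α a t / 2 - e / μ)
      have e1 : 2 / μ * (e * expAvg α a t) = 4 * (expAvg α a t / 2 * (e / μ)) := by ring
      rw [e1]; linarith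
    nlinarith [mul_nonneg hx hy]
  induction t with
  | zero => simp only [expAvg]; positivity
  | succ t ih =>
    have hk := key (t + 1) (by omega)
    have hrec : expAvg α a (t + 1) = α * expAvg α a t + (1 - α) * a (t + 1) := rfl
    set b := expAvg α a (t + 1)
    have h1 : b * (1 + α) ≤ 2 * α * expAvg α a t + 2 * (1 - α) * (A * q ^ (t + 1) + e / μ) := by
      have := mul_le_mul_of_nonneg_left hk (sub_nonneg.2 hα1.le)
      linarith
    have h2 : 2 * α * expAvg α a t ≤ 2 * α * (2 * e / μ + 4 * A * q ^ t) :=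
      mul_le_mul_of_nonneg_left ih (by positivity)
    have hAq : 0 ≤ A * q ^ t := by positivity
    have h3 : 8 * α * (A * q ^ t) + 2 * (1 - α) * (A * q ^ (t + 1)) ≤
        (1 + α) * (4 * A * q ^ (t + 1)) := by
      rw [pow_succ]
      have : 8 * α + 2 * (1 - α) * q ≤ (1 + α) * (4 * q) := by rw [hq_def]; nlinarith
      have := mul_le_mul_of_nonneg_left this hAq
      linarith
    have e1 : 2 * e / μ = 2 * (e / μ) := by ring
    rw [e1] at h2 ⊢
    have h4 : b * (1 + α) ≤ (2 * (e / μ) + 4 * A * q ^ (t + 1)) * (1 + α) := by linarith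
    exact le_of_mul_le_mul_right h4 (by linarith)

end ExpAvg

/-! ### Convergence of the inexact accelerated proximal gradient method -/

section Accelerated

variable {E : Type*} [NormedAddCommGroup E] [NormedSpace ℝ E]

/-- The problem `min_U h + r + μ ω`, where `h` has affine minorants and `L`-quadratic majorants with
slopes `g`, and the Bregman divergence of `ω` is comparable to the squared norm. -/
structure CompositeModel (U : Set E) (r ω : ExtFun E) (h : E → ℝ) (g : E → E →L[ℝ] ℝ)
    (μ L β : ℝ) : Prop where
  convex : Convex ℝ U
  convexOn_r : ConvexOn ℝ U r.val
  le_bregman : ∀ x ∈ U, ∀ x' ∈ U, 1 / 2 * ‖x' - x‖ ^ 2 ≤ bregman ω x' x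
  bregman_le : ∀ x ∈ U, ∀ x' ∈ U, bregman ω x' x ≤ β / 2 * ‖x' - x‖ ^ 2
  minorant : ∀ x ∈ U, ∀ x' ∈ U, h x + g x (x' - x) ≤ h x'
  majorant : ∀ x ∈ U, ∀ x' ∈ U, h x' ≤ h x + g x (x' - x) + L / 2 * ‖x' - x‖ ^ 2
  mu_pos : 0 < μ
  mu_le : μ ≤ L
  exists_argmin : ∀ (G : E →L[ℝ] ℝ) (σ : ℝ), 0 ≤ σ → ∀ c ∈ U, ∃ p, p ∈ U ∧
    IsMinOn (fun u => r.val u + μ * ω.val u + G u + σ * bregman ω u c) U p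

namespace CompositeModel

variable {U : Set E} {r ω : ExtFun E} {h : E → ℝ} {g : E → E →L[ℝ] ℝ} {μ L β : ℝ}

theorem strongConvexOn_reg (M : CompositeModel U r ω h g μ L β) :
    StrongConvexOn U μ (fun x => r.val x + μ * ω.val x) := by
  have h1 : StrongConvexOn U μ (fun x => μ * ω.val x) :=
    strongConvexOn_of_forall_exists_affine_minorant M.convex fun x hx =>
      ⟨μ • fderiv ℝ ω.val x, fun x' hx' => by
        have := mul_le_mul_of_nonneg_left (M.le_bregman x hx x' hx') M.mu_pos.le
        rw [bregman] at this
        simp only [smul_apply, smul_eq_mul]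
        linarith⟩
  have h2 := UniformConvexOn.add (uniformConvexOn_zero.2 M.convexOn_r) h1
  rwa [zero_add] at h2

theorem convexOn_reg (M : CompositeModel U r ω h g μ L β) :
    ConvexOn ℝ U (fun x => r.val x + μ * ω.val x) :=
  strongConvexOn_zero.1 (M.strongConvexOn_reg.mono M.mu_pos.le)

theorem strongConvexOn_obj (M : CompositeModel U r ω h g μ L β) :
    StrongConvexOn U μ (fun x => h x + (r.val x + μ * ω.val x)) := by
  have h1 : StrongConvexOn U 0 h :=
    strongConvexOn_of_forall_exists_affine_minorant M.convex fun x hx =>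
      ⟨g x, fun x' hx' => by have := M.minorant x hx x' hx'; linarith⟩
  have h2 := UniformConvexOn.add (strongConvexOn_zero.1 h1 |> uniformConvexOn_zero.2)
    M.strongConvexOn_reg
  rwa [zero_add] at h2

/-- First-order optimality for the composite objective. -/
theorem reg_ge_of_isMinOn (M : CompositeModel U r ω h g μ L β) {p u : E} (hp : p ∈ U)
    (hmin : IsMinOn (fun x => h x + (r.val x + μ * ω.val x)) U p) (hu : u ∈ U) :
    r.val p + μ * ω.val p - g p (u - p) ≤ r.val u + μ * ω.val u := by
  suffices 0 ≤ g p (u - p) + (r.val u + μ * ω.val u) - (r.val p + μ * ω.val p) by linarith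
  refine nonneg_of_forall_mul_add_sq_mul (b := L / 2 * ‖u - p‖ ^ 2) fun s hs hs1 => ?_
  have hmem : s • u + (1 - s) • p ∈ U := M.convex hu hp hs.le (sub_nonneg.2 hs1) (by ring)
  have h1 := hmin hmem
  have h2 := M.convexOn_reg.2 hu hp hs.le (sub_nonneg.2 hs1) (by ring)
  have h3 := M.majorant p hp _ hmem
  have e : s • u + (1 - s) • p - p = s • (u - p) := by module
  rw [e, map_smul, norm_smul, Real.norm_of_nonneg hs.le] at h3
  simp only [smul_eq_mul, mem_ofPred_eq] at h1 h2 h3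
  linarith

/-- The three-point inequality for a Bregman proximal step. -/
theorem three_point (M : CompositeModel U r ω h g μ L β) {G : E →L[ℝ] ℝ} {σ : ℝ} (hσ : 0 ≤ σ)
    {c p u : E} (hp : p ∈ U)
    (hmin : IsMinOn (fun u => r.val u + μ * ω.val u + G u + σ * bregman ω u c) U p) (hu : u ∈ U) :
    r.val p + μ * ω.val p + G p + σ * bregman ω p c + (μ + σ) * bregman ω u p ≤
      r.val u + μ * ω.val u + G u + σ * bregman ω u c := by
  set l : E →L[ℝ] ℝ := (μ + σ) • fderiv ℝ ω.val p + G - σ • fderiv ℝ ω.val c with hl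
  -- Exact expansion of the non-`r` part around `p`: its deviation from the linearization is a
  -- Bregman divergence. `bregman_le` makes that term quadratic in the step, so the optimality of
  -- `p` bears on the linear part alone.
  have hexp : ∀ u', μ * ω.val u' + G u' + σ * bregman ω u' c =
      μ * ω.val p + G p + σ * bregman ω p c + l (u' - p) + (μ + σ) * bregman ω u' p := by
    intro u'
    simp only [hl, bregman, sub_apply, add_apply, smul_apply, map_sub,
      smul_eq_mul]
    ring
  suffices 0 ≤ r.val u - r.val p + l (u - p) by
    have := hexp u
    linarith
  refine nonneg_of_forall_mul_add_sq_mul (b := (μ + σ) * (β / 2 * ‖u - p‖ ^ 2)) fun s hs hs1 => ?_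
  have hmem : s • u + (1 - s) • p ∈ U := M.convex hu hp hs.le (sub_nonneg.2 hs1) (by ring)
  have h1 := hmin hmem
  have h2 := M.convexOn_r.2 hu hp hs.le (sub_nonneg.2 hs1) (by ring)
  have h3 := mul_le_mul_of_nonneg_left (M.bregman_le p hp _ hmem) (add_nonneg M.mu_pos.le hσ)
  have h4 := hexp (s • u + (1 - s) • p)
  have e : s • u + (1 - s) • p - p = s • (u - p) := by module
  rw [e, norm_smul, Real.norm_of_nonneg hs.le] at h3
  rw [e, map_smul] at h4
  simp only [smul_eq_mul, mem_ofPred_eq] at h1 h2 h3 h4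
  linarith

end CompositeModel

/-- Sequences generated by the method in three-sequence form: prox-points `u`, query points `v`,
running averages `w`, and inexact slopes `G` with error at most `e`. -/
structure IsAccelRun (U : Set E) (r ω : ExtFun E) (g : E → E →L[ℝ] ℝ) (μ α σ e : ℝ)
    (u v w : ℕ → E) (G : ℕ → E →L[ℝ] ℝ) : Prop where
  zero_mem : u 0 ∈ U
  w_zero : w 0 = u 0
  v_succ : ∀ t, v (t + 1) = α • w t + (1 - α) • u t
  w_succ : ∀ t, w (t + 1) = α • w t + (1 - α) • u (t + 1)
  v_mem : ∀ t, v (t + 1) ∈ U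
  w_mem : ∀ t, w t ∈ U
  u_mem : ∀ t, u t ∈ U
  error : ∀ t, ‖G (t + 1) - g (v (t + 1))‖ ≤ e
  isMin : ∀ t, IsMinOn
    (fun x => r.val x + μ * ω.val x + G (t + 1) x + σ * bregman ω x (u t)) U (u (t + 1))

namespace IsAccelRun

variable {U : Set E} {r ω : ExtFun E} {h : E → ℝ} {g : E → E →L[ℝ] ℝ} {μ L β α σ e : ℝ}
  {u v w : ℕ → E} {G : ℕ → E →L[ℝ] ℝ}

/-- Add the majorant at `v (t+1)`, the minorants there towards `w t` and `p` with weights `α` and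
`1-α`, and `1-α` times the three-point inequality. Because `w (t+1) - v (t+1) = (1-α)(u (t+1) - u
t)`, the condition `(1-α)L ≤ σ` absorbs the quadratic term. The condition `(1-α)σ = αμ` makes the
divergences contract by exactly `α`. -/
theorem step_le (S : IsAccelRun U r ω g μ α σ e u v w G) (M : CompositeModel U r ω h g μ L β)
    (hα : 0 < α) (hα1 : α < 1) (hσ : 0 ≤ σ) (h1σ : (1 - α) * σ = α * μ)
    (hLσ : (1 - α) * L ≤ σ) {p : E} (hp : p ∈ U) (t : ℕ) :
    h (w (t + 1)) + (1 - α) * (r.val (u (t + 1)) + μ * ω.val (u (t + 1))) +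
        μ * bregman ω p (u (t + 1)) ≤
      α * h (w t) + α * μ * bregman ω p (u t) +
        (1 - α) * (h p + (r.val p + μ * ω.val p) + e * ‖u (t + 1) - p‖) := by
  have hα' : 0 ≤ 1 - α := sub_nonneg.2 hα1.le
  have hv := S.v_mem t
  have hu := S.u_mem (t + 1)
  set V := v (t + 1) with hV
  set W := w (t + 1) with hW
  have a1 := M.majorant V hv W (S.w_mem _)
  have a2 := mul_le_mul_of_nonneg_left (M.minorant V hv (w t) (S.w_mem _)) hα.le
  have a3 := mul_le_mul_of_nonneg_left (M.minorant V hv p hp) hα'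
  have a4 := mul_le_mul_of_nonneg_left (M.three_point hσ hu (S.isMin t) hp) hα'
  have a5 := mul_le_mul_of_nonneg_left
    (mul_le_mul_of_nonneg_left (M.le_bregman (u t) (S.u_mem t) _ hu) hσ) hα'
  have e1 : W - V = (1 - α) • (u (t + 1) - u t) := by rw [hW, hV, S.w_succ, S.v_succ]; module
  have e2 : g V (W - V) = α * g V (w t - V) + (1 - α) * g V (p - V) +
      (1 - α) * g V (u (t + 1) - p) := by
    have : W - V = α • (w t - V) + (1 - α) • (p - V) + (1 - α) • (u (t + 1) - p) := by
      rw [hW, S.w_succ]; module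
    rw [this]; simp
  rw [e2, e1, norm_smul, Real.norm_of_nonneg hα', mul_pow] at a1
  have a6 : g V (u (t + 1) - p) ≤ G (t + 1) (u (t + 1)) - G (t + 1) p + e * ‖u (t + 1) - p‖ := by
    have b1 := (neg_abs_le _).trans' (neg_le_neg
      ((G (t + 1) - g V).le_of_opNorm_le (S.error t) (u (t + 1) - p)))
    rw [sub_apply, map_sub (G (t + 1))] at b1
    linarith
  have a7 := mul_le_mul_of_nonneg_left a6 hα'
  have a8 : (1 - α) * L * ((1 - α) * ‖u (t + 1) - u t‖ ^ 2) ≤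
      σ * ((1 - α) * ‖u (t + 1) - u t‖ ^ 2) :=
    mul_le_mul_of_nonneg_right hLσ (mul_nonneg hα' (sq_nonneg _))
  have e3 : μ * bregman ω p (u (t + 1)) = (1 - α) * ((μ + σ) * bregman ω p (u (t + 1))) := by
    linear_combination (-bregman ω p (u (t + 1))) * h1σ
  have e4 : α * μ * bregman ω p (u t) = (1 - α) * (σ * bregman ω p (u t)) := by
    linear_combination (-bregman ω p (u t)) * h1σ
  rw [e3, e4]
  linarith

theorem w_eq (S : IsAccelRun U r ω g μ α σ e u v w G) (t : ℕ) :
    w t = α ^ t • u 0 + expAvg α u t := by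
  induction t with
  | zero => simp [expAvg, S.w_zero]
  | succ t ih => rw [S.w_succ, ih, expAvg, pow_succ']; module

/-- The regularizer is averaged over `u 1, …, u t` rather than evaluated at `w t`, so its value at
the starting point never enters. -/
theorem potential_le (S : IsAccelRun U r ω g μ α σ e u v w G)
    (M : CompositeModel U r ω h g μ L β)
    (hα : 0 < α) (hα1 : α < 1) (hσ : 0 ≤ σ) (h1σ : (1 - α) * σ = α * μ)
    (hLσ : (1 - α) * L ≤ σ) {p : E} (hp : p ∈ U) (t : ℕ) :
    h (w t) + expAvg α ((fun x => r.val x + μ * ω.val x) ∘ u) t + μ * bregman ω p (u t) ≤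
      α ^ t * (h (u 0) + μ * bregman ω p (u 0)) +
        (1 - α ^ t) * (h p + (r.val p + μ * ω.val p)) + e * expAvg α (fun t => ‖u t - p‖) t := by
  induction t with
  | zero => simp [expAvg, S.w_zero]
  | succ t ih =>
    have h1 := S.step_le M hα hα1 hσ h1σ hLσ hp t
    have h2 := mul_le_mul_of_nonneg_left ih hα.le
    simp only [expAvg, smul_eq_mul, Function.comp, pow_succ'] at h1 h2 ⊢
    linarith

/-- The minorant at `c` bounds `h (w t) - α ^ t h (u 0)` from below. -/
theorem sub_ge (S : IsAccelRun U r ω g μ α σ e u v w G) (M : CompositeModel U r ω h g μ L β)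
    (hα : 0 < α) {c : E} (hc : c ∈ U) (t : ℕ) :
    (1 - α ^ t) * (h c + g c (weightedAverage (fun i => (α ^ i)⁻¹) u t - c)) -
        α ^ t * (L / 2 * ‖u 0 - c‖ ^ 2) ≤ h (w t) - α ^ t * h (u 0) := by
  have h1 := M.minorant c hc (w t) (S.w_mem t)
  have h2 := mul_le_mul_of_nonneg_left (M.majorant c hc (u 0) S.zero_mem) (pow_pos hα t).le
  have e1 : w t - c = α ^ t • (u 0 - c) +
      (1 - α ^ t) • (weightedAverage (fun i => (α ^ i)⁻¹) u t - c) := by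
    rw [S.w_eq, expAvg_eq_smul_weightedAverage hα]; module
  rw [e1, map_add, map_smul, map_smul] at h1
  simp only [smul_eq_mul] at h1
  linarith

/-- Taking `c = p` in `sub_ge`, first-order optimality of `p` cancels all function values. What
remains bounds `‖u t - p‖²` by a decaying term plus `e` times the average of these same distances,
as `expAvg_le_of_sq_le` requires. -/
theorem expAvg_norm_le (S : IsAccelRun U r ω g μ α σ e u v w G)
    (M : CompositeModel U r ω h g μ L β)
    (hα : 0 < α) (hα1 : α < 1) (hσ : 0 ≤ σ) (h1σ : (1 - α) * σ = α * μ)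
    (hLσ : (1 - α) * L ≤ σ) (he : 0 ≤ e) (hβ : 0 ≤ β) {p : E} (hp : p ∈ U)
    (hmin : IsMinOn (fun x => h x + (r.val x + μ * ω.val x)) U p) (t : ℕ) :
    expAvg α (fun t => ‖u t - p‖) t ≤ 2 * e / μ +
      4 * √(2 * ((μ * β / 2 + L) * ‖u 0 - p‖ ^ 2) / μ) * ((3 + α) / 4) ^ t := by
  have hμ := M.mu_pos
  have hL : 0 < L := hμ.trans_le M.mu_le
  refine expAvg_le_of_sq_le hα hα1 hμ he (by positivity) (fun _ => norm_nonneg _)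
    (fun t ht => ?_) t
  have h1 := S.potential_le M hα hα1 hσ h1σ hLσ hp t
  have h2 := S.sub_ge M hα hp t
  have h3 := M.convexOn_reg.map_weightedAverage_le hα hα1 S.u_mem ht
  have hmem := weightedAverage_mem M.convex hα S.u_mem ht
  have hα' : 0 ≤ 1 - α ^ t := sub_nonneg.2 (pow_le_one₀ hα.le hα1.le)
  have h4 := mul_le_mul_of_nonneg_left (M.reg_ge_of_isMinOn hp hmin hmem) hα'
  have h5 := mul_le_mul_of_nonneg_left (M.le_bregman (u t) (S.u_mem t) p hp) hμ.le
  have hαt := (pow_pos hα t).le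
  have h6 := mul_le_mul_of_nonneg_left
    (mul_le_mul_of_nonneg_left (M.bregman_le (u 0) S.zero_mem p hp) hμ.le) hαt
  have h7 : 0 ≤ α ^ t * (L / 2 * ‖u 0 - p‖ ^ 2) := by positivity
  rw [norm_sub_rev p] at h5 h6
  linarith

/-- Accuracy of the averaged output after enough iterations. -/
theorem gap_le (S : IsAccelRun U r ω g μ α σ e u v w G)
    (M : CompositeModel U r ω h g μ L β)
    (hα : 0 < α) (hα1 : α < 1) (hσ : 0 ≤ σ) (h1σ : (1 - α) * σ = α * μ)
    (hLσ : (1 - α) * L ≤ σ) (he : 0 ≤ e) (hβ : 0 ≤ β) {p : E} (hp : p ∈ U)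
    (hmin : IsMinOn (fun x => h x + (r.val x + μ * ω.val x)) U p)
    {η : ℝ} (hη : 0 < η) (heη : 784 * e ^ 2 ≤ η * μ) {t : ℕ} (ht : 1 ≤ t)
    (hqt : ((3 + α) / 4) ^ t *
      (12 * ((μ * β / 2 + L) * ‖u 0 - p‖ ^ 2) / η + 2 + 4 * L / μ) ≤ 1) :
    let ū := weightedAverage (fun i => (α ^ i)⁻¹) u t
    h ū + (r.val ū + μ * ω.val ū) ≤ h p + (r.val p + μ * ω.val p) + η := by
  intro ū
  have hμ := M.mu_pos
  have hL : 0 < L := hμ.trans_le M.mu_le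
  have hmem : ū ∈ U := weightedAverage_mem M.convex hα S.u_mem ht
  have hα' : 0 ≤ 1 - α ^ t := sub_nonneg.2 (pow_le_one₀ hα.le hα1.le)
  have hαt := (pow_pos hα t).le
  have h1 := S.potential_le M hα hα1 hσ h1σ hLσ hp t
  have h2 := S.sub_ge M hα hmem t
  have h3 := M.convexOn_reg.map_weightedAverage_le hα hα1 S.u_mem ht
  have h4 := mul_nonneg hμ.le ((by positivity : (0:ℝ) ≤ 1 / 2 * ‖p - u t‖ ^ 2).trans
    (M.le_bregman (u t) (S.u_mem t) p hp))
  have h5 := mul_le_mul_of_nonneg_left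
    (mul_le_mul_of_nonneg_left (M.bregman_le (u 0) S.zero_mem p hp) hμ.le) hαt
  have h6 := M.strongConvexOn_obj.add_sq_le_of_isMinOn hp hmin hmem
  have hb := S.expAvg_norm_le M hα hα1 hσ h1σ hLσ he hβ hp hmin t
  -- The lower bound `sub_ge` at `ū` costs a multiple of `‖u 0 - ū‖²`. Its part `‖ū - p‖²` is at
  -- most `2 gap / μ` by strong convexity and is absorbed into the left side (`c5`, `f2`).
  have hnorm : ‖u 0 - ū‖ ^ 2 ≤ 2 * ‖u 0 - p‖ ^ 2 + 2 * ‖ū - p‖ ^ 2 := by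
    have := norm_sub_le (u 0 - p) (ū - p)
    rw [sub_sub_sub_cancel_right] at this
    have h0 := norm_nonneg (u 0 - ū)
    nlinarith [sq_nonneg (‖u 0 - p‖ - ‖ū - p‖)]
  set q := (3 + α) / 4 with hq_def
  have hq : 0 < q := by positivity
  have hαq : α ^ t ≤ q ^ t := pow_le_pow_left₀ hα.le (by rw [hq_def]; linarith) t
  have hq1 : q ^ t ≤ 1 := pow_le_one₀ hq.le (by rw [hq_def]; linarith)
  set C := (μ * β / 2 + L) * ‖u 0 - p‖ ^ 2 with hC_def
  have hC : 0 ≤ C := by positivity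
  set A := √(2 * C / μ)
  have hA2 : A ^ 2 = 2 * C / μ := Real.sq_sqrt (by positivity)
  set gap := h ū + (r.val ū + μ * ω.val ū) - (h p + (r.val p + μ * ω.val p)) with hgap
  -- consequences of the choice of `t`
  have hqt0 : 0 ≤ q ^ t := (pow_pos hq t).le
  have c1 : q ^ t * (12 * C / η) + 2 * q ^ t + q ^ t * (4 * L / μ) ≤ 1 := by linarith
  have c2 : 0 ≤ q ^ t * (12 * C / η) := by positivity
  have c3 : 0 ≤ q ^ t * (4 * L / μ) := by positivity
  have c4 : 12 * (q ^ t * C) ≤ η := by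
    have : q ^ t * (12 * C / η) ≤ 1 := by linarith
    rw [mul_div_assoc', div_le_one hη] at this
    linarith
  have c5 : α ^ t * (1 + 2 * L / μ) ≤ 1 / 2 := by
    have : α ^ t * (1 + 2 * L / μ) ≤ q ^ t * (1 + 2 * L / μ) :=
      mul_le_mul_of_nonneg_right hαq (by positivity)
    have e1 : q ^ t * (4 * L / μ) = 2 * (q ^ t * (2 * L / μ)) := by ring
    linarith
  -- the error term
  have d1 : e * expAvg α (fun t => ‖u t - p‖) t ≤ 6 * (e ^ 2 / μ) + 2 * (q ^ t * C) := by
    have b1 := mul_le_mul_of_nonneg_left hb he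
    have b2 : 4 * (e * A) ≤ μ * A ^ 2 + 4 * (e ^ 2 / μ) := by
      have := sq_nonneg (μ * A - 2 * e)
      have e1 : 4 * (e ^ 2 / μ) = 4 * e ^ 2 / μ := by ring
      rw [e1, ← sub_le_iff_le_add', le_div_iff₀ hμ]
      linarith
    have b3 : μ * A ^ 2 = 2 * C := by rw [hA2]; field_simp
    have b4 := mul_le_mul_of_nonneg_left b2 hqt0
    have b5 : q ^ t * (4 * (e ^ 2 / μ)) ≤ 1 * (4 * (e ^ 2 / μ)) :=
      mul_le_mul_of_nonneg_right hq1 (by positivity)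
    have e2 : e * (2 * e / μ) = 2 * (e ^ 2 / μ) := by ring
    rw [b3] at b4
    linarith
  have d2 : 784 * (e ^ 2 / μ) ≤ η := by
    rw [mul_div_assoc', div_le_iff₀ hμ]; exact heη
  have d3 : ‖ū - p‖ ^ 2 ≤ 2 * gap / μ := by
    rw [le_div_iff₀ hμ]; linarith
  have hgap0 : 0 ≤ gap := by
    have := hmin hmem
    exact sub_nonneg.2 this
  have f1 : (1 - α ^ t) * gap ≤
      α ^ t * (μ * (β / 2 * ‖p - u 0‖ ^ 2) + L / 2 * ‖u 0 - ū‖ ^ 2) +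
        e * expAvg α (fun t => ‖u t - p‖) t := by
    rw [sub_self, map_zero, add_zero] at h2
    simp only [hgap] at h3 ⊢
    linarith
  have f2 : α ^ t * (μ * (β / 2 * ‖p - u 0‖ ^ 2) + L / 2 * ‖u 0 - ū‖ ^ 2) ≤
      α ^ t * C + α ^ t * (2 * L / μ) * gap := by
    have b1 := mul_le_mul_of_nonneg_left (hnorm.trans (add_le_add_right
      (mul_le_mul_of_nonneg_left d3 zero_le_two) _)) (half_pos hL).le
    have e1 : μ * (β / 2 * ‖p - u 0‖ ^ 2) + L / 2 * (2 * ‖u 0 - p‖ ^ 2 + 2 * (2 * gap / μ)) =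
        C + 2 * L / μ * gap := by rw [hC_def, norm_sub_rev p]; ring
    have := mul_le_mul_of_nonneg_left
      (add_le_add_right b1 (μ * (β / 2 * ‖p - u 0‖ ^ 2))) hαt
    rw [e1] at this
    linarith
  have f3 : α ^ t * C ≤ q ^ t * C := mul_le_mul_of_nonneg_right hαq hC
  have f4 := mul_le_mul_of_nonneg_right c5 hgap0
  -- Half of the gap is at most `3 q^t C + 6 e²/μ`, hence at most `η/4 + 6η/784`.
  have : gap ≤ η := by linarith
  linarith

end IsAccelRun

end Accelerated

theorem argminOn_spec {E : Type*} [NormedAddCommGroup E] {F : E → ℝ} {s : Set E} (h : ∃ p, p ∈ s ∧ IsMinOn F s p) :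
    argminOn F s ∈ s ∧ IsMinOn F s (argminOn F s) :=
  Classical.epsilon_spec h

/-! ### From the implemented recursion to the abstract accelerated scheme -/

section Accelerated

variable {E : Type*} [NormedAddCommGroup E] [NormedSpace ℝ E]

theorem apgState_calls (U : Set E) (φ ω : ExtFun E) (μ α τ σ : ℝ) (grad : E → (E →L[ℝ] ℝ)) (u0 : E)
    (t : ℕ) : (apgState U φ ω μ α τ σ grad u0 t).calls = t := by
  induction t with
  | zero => rfl
  | succ t ih => simp [apgState, apgStep, ih]

/-- The momentum form hides the running average `w = hat + (1+τ)⁻¹(cur - prev)`. The extrapolated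
point `tilde` may leave `U`, but the query point is a convex combination of `w` and `cur`, both in
`U`, so the oracle is called only where its error is controlled. -/
theorem isAccelRun_apgState {U : Set E} {r ω : ExtFun E} {h : E → ℝ} {g grad : E → E →L[ℝ] ℝ}
    {μ L β τ σ e : ℝ} (M : CompositeModel U r ω h g μ L β) (hτ : 0 < τ) (hσ : 0 ≤ σ)
    (hgrad : ∀ x ∈ U, ‖grad x - g x‖ ≤ e) {u0 : E} (hu0 : u0 ∈ U) :
    let s := apgState U r ω μ (τ / (1 + τ)) τ σ grad u0
    IsAccelRun U r ω g μ (τ / (1 + τ)) σ e (fun t => (s t).cur) (fun t => (s t).hat)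
      (fun t => (s t).hat + (1 + τ)⁻¹ • ((s t).cur - (s t).prev)) (fun t => grad (s t).hat) := by
  intro s
  have hτ1 : (1 + τ) ≠ 0 := by positivity
  have e1 : 1 - τ / (1 + τ) = (1 + τ)⁻¹ := by field_simp; ring
  have hα : 0 ≤ τ / (1 + τ) := by positivity
  have hα' : (0 : ℝ) ≤ (1 + τ)⁻¹ := by positivity
  have hsum : τ / (1 + τ) + (1 + τ)⁻¹ = 1 := by rw [← e1]; ring
  have hhat : ∀ t, (s (t + 1)).hat = (τ / (1 + τ)) • ((s t).hat +
      (1 + τ)⁻¹ • ((s t).cur - (s t).prev)) + (1 + τ)⁻¹ • (s t).cur := fun t => by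
    simp only [s, apgState, apgStep]
    rw [div_eq_mul_inv]
    module
  have hprev : ∀ t, (s (t + 1)).prev = (s t).cur := fun t => rfl
  have hw : ∀ t, (s (t + 1)).hat + (1 + τ)⁻¹ • ((s (t + 1)).cur - (s (t + 1)).prev) =
      (τ / (1 + τ)) • ((s t).hat + (1 + τ)⁻¹ • ((s t).cur - (s t).prev)) +
        (1 + τ)⁻¹ • (s (t + 1)).cur := fun t => by
    rw [hhat, hprev]; module
  have hcur : ∀ t, (s t).cur ∈ U → (s (t + 1)).cur ∈ U ∧ IsMinOn
      (fun x => r.val x + μ * ω.val x + grad (s (t + 1)).hat x + σ * bregman ω x (s t).cur) U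
      (s (t + 1)).cur := fun t ht => by
    exact argminOn_spec (M.exists_argmin (grad (s (t + 1)).hat) σ hσ _ ht)
  have hmem : ∀ t, (s t).cur ∈ U ∧ (s t).hat + (1 + τ)⁻¹ • ((s t).cur - (s t).prev) ∈ U := by
    intro t
    induction t with
    | zero => simpa [s, apgState] using hu0
    | succ t ih =>
      refine ⟨(hcur t ih.1).1, ?_⟩
      rw [hw]
      exact M.convex ih.2 (hcur t ih.1).1 hα hα' hsum
  have hvmem : ∀ t, (s (t + 1)).hat ∈ U := fun t => by
    rw [hhat]
    exact M.convex (hmem t).2 (hmem t).1 hα hα' hsum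
  exact
    { zero_mem := hu0
      w_zero := by simp [s, apgState]
      v_succ := fun t => by rw [e1]; exact hhat t
      w_succ := fun t => by rw [e1]; exact hw t
      v_mem := hvmem
      w_mem := fun t => (hmem t).2
      u_mem := fun t => (hmem t).1
      error := fun t => hgrad _ (hvmem t)
      isMin := fun t => (hcur t (hmem t).1).2 }

/-- Accuracy of the averaged output with the standard parameters. -/
theorem apg_gap_le {U : Set E} {r ω : ExtFun E} {h : E → ℝ} {g grad : E → E →L[ℝ] ℝ}
    {μ L β e : ℝ} (M : CompositeModel U r ω h g μ L β) (hβ : 0 ≤ β) (he : 0 ≤ e)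
    (hgrad : ∀ x ∈ U, ‖grad x - g x‖ ≤ e) {u0 : E} (hu0 : u0 ∈ U) {p : E} (hp : p ∈ U)
    (hmin : IsMinOn (fun x => h x + (r.val x + μ * ω.val x)) U p)
    {η : ℝ} (hη : 0 < η) (heη : 784 * e ^ 2 ≤ η * μ) {t : ℕ} (ht : 1 ≤ t)
    (hlog : 4 * (1 + √(L / μ)) *
      Real.log (12 * ((μ * β / 2 + L) * ‖u0 - p‖ ^ 2) / η + 2 + 4 * L / μ) ≤ t) :
    let τ := √(L / μ)
    let ū := weightedAverage (fun i => ((τ / (1 + τ)) ^ i)⁻¹)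
      (fun i => (apgState U r ω μ (τ / (1 + τ)) τ (√(L * μ)) grad u0 i).cur) t
    ū ∈ U ∧ h ū + (r.val ū + μ * ω.val ū) ≤ h p + (r.val p + μ * ω.val p) + η := by
  intro τ ū
  have hμ := M.mu_pos
  have hL : 0 < L := hμ.trans_le M.mu_le
  have hτ : 0 < τ := Real.sqrt_pos.2 (by positivity)
  have hτ2 : τ ^ 2 * μ = L := by
    rw [Real.sq_sqrt (by positivity), div_mul_cancel₀ _ hμ.ne']
  have hσ : √(L * μ) = τ * μ := by
    rw [show L * μ = (τ * μ) ^ 2 by rw [← hτ2]; ring, Real.sqrt_sq (by positivity)]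
  have hα : 0 < τ / (1 + τ) := by positivity
  have hα1 : τ / (1 + τ) < 1 := by rw [div_lt_one (by positivity)]; linarith
  have S := isAccelRun_apgState M hτ (Real.sqrt_nonneg (L * μ)) hgrad hu0
  refine ⟨weightedAverage_mem M.convex hα S.u_mem ht, ?_⟩
  refine S.gap_le M hα hα1 (Real.sqrt_nonneg _) ?_ ?_ he hβ hp hmin hη heη ht ?_
  · rw [hσ]; field_simp; ring
  · rw [hσ, ← hτ2, show 1 - τ / (1 + τ) = 1 / (1 + τ) by field_simp; ring,
      div_mul_eq_mul_div, div_le_iff₀ (by positivity)]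
    nlinarith [mul_pos hτ hμ]
  · change _ * (12 * ((μ * β / 2 + L) * ‖u0 - p‖ ^ 2) / η + 2 + 4 * L / μ) ≤ 1
    set M' := 12 * ((μ * β / 2 + L) * ‖u0 - p‖ ^ 2) / η + 2 + 4 * L / μ with hM'
    have hM0 : 0 < M' := by positivity
    set q := (3 + τ / (1 + τ)) / 4 with hq
    -- Together with `1 - s ≤ exp (-s)` this turns the required number of iterations into `4(1+τ)`
    -- times a logarithm.
    have hq1 : q = -(1 / (4 * (1 + τ))) + 1 := by rw [hq]; field_simp; ring
    have h1 : q ^ t ≤ Real.exp (-(1 / (4 * (1 + τ)))) ^ t :=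
      pow_le_pow_left₀ (by positivity) (by rw [hq1]; exact Real.add_one_le_exp _) t
    have h2 : Real.log M' ≤ t * (1 / (4 * (1 + τ))) := by
      rw [mul_one_div, le_div_iff₀ (by positivity)]; linarith
    calc q ^ t * M' ≤ Real.exp (-(1 / (4 * (1 + τ)))) ^ t * M' :=
          mul_le_mul_of_nonneg_right h1 hM0.le
      _ = Real.exp (Real.log M' - t * (1 / (4 * (1 + τ)))) := by
          rw [← Real.exp_nat_mul, Real.exp_sub, Real.exp_log hM0, mul_neg, Real.exp_neg,
            mul_comm, ← div_eq_mul_inv]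
      _ ≤ 1 := by rw [Real.exp_le_one_iff]; linarith

end Accelerated

/-! ### Regularity of the smoothed minimax problem and of its proximal subproblems -/

namespace Constants

variable {c : Constants}

theorem lam_inv : c.lam⁻¹ = 2 * c.γ := by simp [lam]

theorem mu_eq : c.mu = c.γ := by rw [mu, lam_inv]; ring

end Constants

namespace MinimaxProblem

/-- Lets the unsmoothed proximal problem be treated as the case `ρ = 0` of the smoothed one. -/
theorem fSmooth_zero {X Y : Type*} (P : MinimaxProblem X Y) : P.fSmooth 0 = P.f := by
  ext x
  have : P.phiD 0 x = fun y => P.Φ x y - P.g.val y := by ext y; simp [phiD]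
  rw [fSmooth, f, this]

/-- The split of `λ⁻¹ ω` into `γ ω`, which compensates the weak convexity of the smooth part, and `μ
ω`, which stays in the regularizer. -/
theorem QSmooth_eq {X Y : Type*} [NormedAddCommGroup X] [NormedSpace ℝ X]
    (P : MinimaxProblem X Y) (c : Constants) (ρ : ℝ) (x z : X) : P.QSmooth ρ c.lam x z =
    P.fSmooth ρ x + c.γ * P.ωX.val x -
        c.lam⁻¹ * (P.ωX.val z + fderiv ℝ P.ωX.val z (x - z)) +
      (P.r.val x + c.mu * P.ωX.val x) := by
  rw [QSmooth, bregman, Constants.mu]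
  ring

variable {X Y : Type*} [NormedAddCommGroup X] [NormedSpace ℝ X]
  [NormedAddCommGroup Y] [NormedSpace ℝ Y]

variable {P : MinimaxProblem X Y} {c : Constants}

/-- A maximizer of the smoothed inner objective. -/
def dualArgmax (P : MinimaxProblem X Y) (ρ : ℝ) (x : X) : Y :=
  Classical.epsilon fun y => y ∈ P.𝒴 ∧ ∀ y' ∈ P.𝒴, P.phiD ρ x y' ≤ P.phiD ρ x y

theorem QSmooth_zero (l : ℝ) (x' x : X) : P.QSmooth 0 l x' x = P.Q l x' x := by
  rw [QSmooth, Q, fSmooth_zero, q]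

namespace Assumptions

theorem nbhd_subset_interior (H : P.Assumptions c) : P.nbhd ⊆ interior P.ωX.dom :=
  interior_maximal H.nbhd_subset_dom H.open_nbhd

theorem relDom_eq (H : P.Assumptions c) : relDom P.ωX P.𝒳 = P.𝒳 :=
  inter_eq_left.2 (H.subset_nbhd.trans H.nbhd_subset_interior)

theorem differentiableAt_ωX (H : P.Assumptions c) {x : X} (hx : x ∈ P.𝒳) :
    DifferentiableAt ℝ P.ωX.val x :=
  H.differentiable_ωX.differentiableAt (H.open_nbhd.mem_nhds (H.subset_nbhd hx))

theorem differentiableAt_Φ (H : P.Assumptions c) {x : X} (hx : x ∈ P.𝒳) {y : Y} (hy : y ∈ P.𝒴) :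
    DifferentiableAt ℝ (fun x => P.Φ x y) x :=
  (H.differentiable_Φ y hy).differentiableAt (H.open_nbhd.mem_nhds (H.subset_nbhd hx))

theorem le_bregman (H : P.Assumptions c) {x : X} (hx : x ∈ P.𝒳) {x' : X} (hx' : x' ∈ P.𝒳) :
    1 / 2 * ‖x' - x‖ ^ 2 ≤ bregman P.ωX x' x := by
  have := H.dgf_X.strongConvexOn.add_fderiv_add_sq_le hx hx' (H.differentiableAt_ωX hx)
  rw [bregman]
  linarith

theorem bregman_le (H : P.Assumptions c) {x : X} (hx : x ∈ P.𝒳) {x' : X} (hx' : x' ∈ P.𝒳) :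
    bregman P.ωX x' x ≤ c.β / 2 * ‖x' - x‖ ^ 2 := by
  have := le_add_fderiv_add_sq_of_lipschitz H.convex_𝒳 (fun x hx => H.differentiableAt_ωX hx)
    H.β_bound hx hx'
  rw [bregman]
  linarith

theorem Φ_le (H : P.Assumptions c) {x : X} (hx : x ∈ P.𝒳) {x' : X} (hx' : x' ∈ P.𝒳) {y : Y}
    (hy : y ∈ P.𝒴) :
    P.Φ x' y ≤ P.Φ x y + P.primalOracle x y (x' - x) + c.Lxx / 2 * ‖x' - x‖ ^ 2 :=
  le_add_fderiv_add_sq_of_lipschitz (F := fun x => P.Φ x y) H.convex_𝒳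
    (fun _ hx => H.differentiableAt_Φ hx hy)
    (fun x hx x' hx' => H.Lxx_bound x hx x' hx' y hy) hx hx'

theorem convexOn_r (H : P.Assumptions c) : ConvexOn ℝ P.𝒳 P.r.val :=
  H.ccp_r.convex.subset H.lipschitz_r.1 H.convex_𝒳

theorem convexOn_g (H : P.Assumptions c) : ConvexOn ℝ P.𝒴 P.g.val :=
  H.ccp_g.convex.subset H.lipschitz_g.1 H.convex_𝒴

theorem continuousOn_g (H : P.Assumptions c) : ContinuousOn P.g.val P.𝒴 := by
  obtain ⟨-, M, hM⟩ := H.lipschitz_g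
  refine (LipschitzOnWith.of_dist_le_mul (K := M.toNNReal) fun y hy y' hy' => ?_).continuousOn
  rw [Real.dist_eq, dist_eq_norm]
  exact (hM y hy y' hy').trans
    (mul_le_mul_of_nonneg_right (Real.le_coe_toNNReal M) (norm_nonneg _))

theorem continuousOn_phiD (H : P.Assumptions c) (ρ : ℝ) {x : X} (hx : x ∈ P.𝒳) :
    ContinuousOn (P.phiD ρ x) P.𝒴 := by
  have h1 : ContinuousOn (P.Φ x) P.𝒴 :=
    H.continuous_Φ.comp (f := fun y => (x, y)) (by fun_prop) fun y hy => ⟨hx, hy⟩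
  exact (h1.sub H.continuousOn_g).sub (H.dgf_Y.continuousOn.const_smul ρ)

theorem strongConvexOn_neg_phiD (H : P.Assumptions c) {ρ : ℝ} (hρ : 0 ≤ ρ) {x : X}
    (hx : x ∈ P.𝒳) : StrongConvexOn P.𝒴 ρ (fun y => -P.phiD ρ x y) := by
  refine ⟨H.convex_𝒴, fun y hy y' hy' a b ha hb hab => ?_⟩
  have h1 := (H.concave_Φ x hx).2 hy hy' ha hb hab
  have h2 := H.convexOn_g.2 hy hy' ha hb hab
  have h3 := mul_le_mul_of_nonneg_left (H.dgf_Y.strongConvexOn.2 hy hy' ha hb hab) hρ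
  simp only [phiD, smul_eq_mul] at *
  linarith

theorem β_pos (H : P.Assumptions c) : 0 < c.β := one_pos.trans_le H.one_le_β

theorem lam_pos (H : P.Assumptions c) : 0 < c.lam := by
  have := H.γ_pos
  rw [Constants.lam]; positivity

theorem acc_pos (H : P.Assumptions c) {ε : ℝ} (hε : 0 < ε) : 0 < c.acc ε := by
  have := H.lam_pos
  have := H.β_pos
  rw [Constants.acc]; positivity

theorem le_Lrho (H : P.Assumptions c) {ρ : ℝ} (hρ : 0 < ρ) : c.γ ≤ c.Lrho ρ := by
  have h1 := H.γ_pos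
  have h2 := H.β_pos
  have h3 := H.γ_le
  rw [Constants.Lrho, Constants.lam_inv]
  have : 0 ≤ c.Lxy ^ 2 / ρ := by positivity
  have : 0 ≤ 2 * c.γ * c.β := by positivity
  linarith

theorem rho_pos (H : P.Assumptions c) {ε : ℝ} (hε : 0 < ε) : 0 < P.rho c ε :=
  div_pos (H.acc_pos hε) (mul_pos four_pos H.Omega_pos)

variable [FiniteDimensional ℝ Y]

theorem isCompact_𝒴 (H : P.Assumptions c) : IsCompact P.𝒴 :=
  have : ProperSpace Y := FiniteDimensional.proper ℝ Y
  Metric.isCompact_of_isClosed_isBounded H.closed_𝒴 H.bounded_𝒴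

theorem dualArgmax_spec (H : P.Assumptions c) (ρ : ℝ) {x : X} (hx : x ∈ P.𝒳) :
    P.dualArgmax ρ x ∈ P.𝒴 ∧ ∀ y ∈ P.𝒴, P.phiD ρ x y ≤ P.phiD ρ x (P.dualArgmax ρ x) :=
  Classical.epsilon_spec (p := fun y => y ∈ P.𝒴 ∧ ∀ y' ∈ P.𝒴, P.phiD ρ x y' ≤ P.phiD ρ x y) <| by
    obtain ⟨y, hy, hmax⟩ := H.isCompact_𝒴.exists_isMaxOn H.nonempty_𝒴 (H.continuousOn_phiD ρ hx)
    exact ⟨y, hy, fun y' hy' => hmax hy'⟩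

theorem fSmooth_eq (H : P.Assumptions c) (ρ : ℝ) {x : X} (hx : x ∈ P.𝒳) :
    P.fSmooth ρ x = P.phiD ρ x (P.dualArgmax ρ x) := by
  obtain ⟨h1, h2⟩ := H.dualArgmax_spec ρ hx
  exact IsGreatest.csSup_eq ⟨mem_image_of_mem _ h1, forall_mem_image.2 h2⟩

theorem phiD_le_fSmooth (H : P.Assumptions c) (ρ : ℝ) {x : X} (hx : x ∈ P.𝒳) {y : Y}
    (hy : y ∈ P.𝒴) : P.phiD ρ x y ≤ P.fSmooth ρ x := by
  rw [H.fSmooth_eq ρ hx]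
  exact (H.dualArgmax_spec ρ hx).2 y hy

theorem phiD_add_sq_le (H : P.Assumptions c) {ρ : ℝ} (hρ : 0 ≤ ρ) {x : X} (hx : x ∈ P.𝒳) {y : Y}
    (hy : y ∈ P.𝒴) : P.phiD ρ x y + ρ / 2 * ‖y - P.dualArgmax ρ x‖ ^ 2 ≤ P.fSmooth ρ x := by
  obtain ⟨h1, h2⟩ := H.dualArgmax_spec ρ hx
  have := (H.strongConvexOn_neg_phiD hρ hx).add_sq_le_of_isMinOn h1
    (fun y hy => neg_le_neg (h2 y hy)) hy
  rw [H.fSmooth_eq ρ hx]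
  linarith

/-- Freeze `y` at its maximizer for `x`; the weak convexity bound of that single function lies below
the maximum at `x'`. -/
theorem fSmooth_minorant (H : P.Assumptions c) (ρ : ℝ) {x : X} (hx : x ∈ P.𝒳) {x' : X}
    (hx' : x' ∈ P.𝒳) :
    P.fSmooth ρ x + P.primalOracle x (P.dualArgmax ρ x) (x' - x) - c.γ / 2 * ‖x' - x‖ ^ 2 ≤
      P.fSmooth ρ x' := by
  have hy := (H.dualArgmax_spec ρ hx).1
  have h1 := H.phiD_le_fSmooth ρ hx' hy
  have h2 := H.weakConvex_Φ _ hy x hx x' hx'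
  rw [H.fSmooth_eq ρ hx]
  simp only [phiD] at h1 ⊢
  linarith

/-- Use the descent lemma for the maximizer `y'` at `x'`, then replace `y'` by `y` in the slope. The
cost `Lxy ‖y' - y‖ ‖x' - x‖` is paid, by Young's inequality, from the deficit `ρ/2 ‖y' - y‖²` of
`y'` at `x`, leaving `Lxy²/(2ρ) ‖x' - x‖²`. -/
theorem fSmooth_majorant (H : P.Assumptions c) {ρ : ℝ} (hρ : 0 < ρ) {x : X} (hx : x ∈ P.𝒳)
    {x' : X} (hx' : x' ∈ P.𝒳) :
    P.fSmooth ρ x' ≤ P.fSmooth ρ x + P.primalOracle x (P.dualArgmax ρ x) (x' - x) +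
      (c.Lxx + c.Lxy ^ 2 / ρ) / 2 * ‖x' - x‖ ^ 2 := by
  have hy := (H.dualArgmax_spec ρ hx).1
  have hy' := (H.dualArgmax_spec ρ hx').1
  rw [H.fSmooth_eq ρ hx']
  set y := P.dualArgmax ρ x
  set y' := P.dualArgmax ρ x'
  have h1 := H.Φ_le hx hx' hy'
  have h2 := H.phiD_add_sq_le hρ.le hx hy'
  have h3 := (le_abs_self _).trans
    ((P.primalOracle x y' - P.primalOracle x y).le_of_opNorm_le (H.Lxy_bound x hx y' hy' y hy)
      (x' - x))
  rw [sub_apply] at h3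
  have h4 : c.Lxy * ‖y' - y‖ * ‖x' - x‖ ≤
      ρ / 2 * ‖y' - y‖ ^ 2 + c.Lxy ^ 2 / ρ / 2 * ‖x' - x‖ ^ 2 := by
    have := sq_nonneg (ρ * ‖y' - y‖ - c.Lxy * ‖x' - x‖)
    have e : ρ / 2 * ‖y' - y‖ ^ 2 + c.Lxy ^ 2 / ρ / 2 * ‖x' - x‖ ^ 2 =
        (ρ ^ 2 * ‖y' - y‖ ^ 2 + c.Lxy ^ 2 * ‖x' - x‖ ^ 2) / (2 * ρ) := by field_simp
    rw [e, le_div_iff₀ (by positivity)]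
    linarith
  simp only [phiD] at h1 h2 ⊢
  linarith

theorem abs_ωY_le (H : P.Assumptions c) {y : Y} (hy : y ∈ P.𝒴) : |P.ωY.val y| ≤ P.Omega :=
  le_csSup (H.isCompact_𝒴.bddAbove_image H.dgf_Y.continuousOn.abs) (mem_image_of_mem _ hy)

theorem abs_fSmooth_sub_f_le (H : P.Assumptions c) {ε : ℝ} (hε : 0 < ε) {x : X} (hx : x ∈ P.𝒳) :
    |P.fSmooth (P.rho c ε) x - P.f x| ≤ c.acc ε / 4 := by
  have hρ := H.rho_pos hε
  have hρΩ : P.rho c ε * P.Omega = c.acc ε / 4 := by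
    have := H.Omega_pos
    rw [rho]; field_simp
  have key : ∀ y ∈ P.𝒴, |P.rho c ε * P.ωY.val y| ≤ c.acc ε / 4 := fun y hy => by
    rw [abs_mul, abs_of_pos hρ, ← hρΩ]
    exact mul_le_mul_of_nonneg_left (H.abs_ωY_le hy) hρ.le
  rw [← fSmooth_zero, abs_le]
  have m1 := (H.dualArgmax_spec (P.rho c ε) hx).1
  have m2 := (H.dualArgmax_spec 0 hx).1
  constructor
  · have h1 := H.phiD_le_fSmooth (P.rho c ε) hx m2
    have h2 := abs_le.1 (key _ m2)
    rw [H.fSmooth_eq 0 hx]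
    simp only [phiD] at h1 ⊢
    linarith
  · have h1 := H.phiD_le_fSmooth 0 hx m1
    have h2 := abs_le.1 (key _ m1)
    rw [H.fSmooth_eq (P.rho c ε) hx]
    simp only [phiD] at h1 ⊢
    linarith

/-- The regularized proximal objective is strongly convex. -/
theorem strongConvexOn_QSmooth (H : P.Assumptions c) (ρ : ℝ) (z : X) :
    StrongConvexOn P.𝒳 c.γ (fun x => P.QSmooth ρ c.lam x z) := by
  have h1 : StrongConvexOn P.𝒳 c.γ
      (fun x => P.fSmooth ρ x + c.lam⁻¹ * bregman P.ωX x z) := by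
    refine strongConvexOn_of_forall_exists_affine_minorant H.convex_𝒳 fun x hx =>
      ⟨P.primalOracle x (P.dualArgmax ρ x) +
        (2 * c.γ) • (fderiv ℝ P.ωX.val x - fderiv ℝ P.ωX.val z), fun x' hx' => ?_⟩
    have a1 := H.fSmooth_minorant ρ hx hx'
    have a2 := mul_le_mul_of_nonneg_left (H.le_bregman hx hx') H.γ_pos.le
    simp only [Constants.lam_inv, bregman, add_apply, sub_apply, smul_apply, smul_eq_mul,
      map_sub] at a1 a2 ⊢
    linarith
  have h2 := UniformConvexOn.add h1 (uniformConvexOn_zero.2 H.convexOn_r)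
  rw [add_zero] at h2
  refine ⟨H.convex_𝒳, fun x hx y hy a b ha hb hab => ?_⟩
  have := h2.2 hx hy ha hb hab
  simp only [Pi.add_apply, QSmooth, smul_eq_mul] at this ⊢
  linarith

theorem exists_isMinOn_QSmooth [FiniteDimensional ℝ X] (H : P.Assumptions c) (ρ : ℝ)
    (z : X) : ∃ p ∈ P.𝒳, IsMinOn (fun x => P.QSmooth ρ c.lam x z) P.𝒳 p := by
  obtain ⟨-, Mr, hMr⟩ := H.lipschitz_r
  refine exists_isMinOn_of_quadratic_minorant H.closed_𝒳 H.nonempty_𝒳 H.γ_pos fun x hx => ?_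
  set l : X →L[ℝ] ℝ := P.primalOracle x (P.dualArgmax ρ x) +
        (2 * c.γ) • (fderiv ℝ P.ωX.val x - fderiv ℝ P.ωX.val z) with hl
  refine ⟨Mr + ‖l‖, fun x' hx' => ?_⟩
  have a1 := H.fSmooth_minorant ρ hx hx'
  have a2 := mul_le_mul_of_nonneg_left (H.le_bregman hx hx') H.γ_pos.le
  have a3 := (neg_abs_le (l (x' - x))).trans' (neg_le_neg (l.le_opNorm (x' - x)))
  have a4 := (abs_le.1 (hMr x' hx' x hx)).1
  simp only [hl, QSmooth, Constants.lam_inv, bregman, add_apply, sub_apply, smul_apply,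
    smul_eq_mul, map_sub] at a1 a2 a3 a4 ⊢
  linarith

/-- The proximal subproblem as a composite problem. -/
theorem compositeModel [FiniteDimensional ℝ X] (H : P.Assumptions c) {ρ : ℝ} (hρ : 0 < ρ) (z : X) :
    CompositeModel P.𝒳 P.r P.ωX
      (fun x => P.fSmooth ρ x + c.γ * P.ωX.val x -
        c.lam⁻¹ * (P.ωX.val z + fderiv ℝ P.ωX.val z (x - z)))
      (fun x => c.γ • fderiv ℝ P.ωX.val x + P.primalOracle x (P.dualArgmax ρ x) -
        c.lam⁻¹ • fderiv ℝ P.ωX.val z) c.mu (c.Lrho ρ) c.β where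
  convex := H.convex_𝒳
  convexOn_r := H.convexOn_r
  le_bregman x hx x' hx' := H.le_bregman hx hx'
  bregman_le x hx x' hx' := H.bregman_le hx hx'
  minorant x hx x' hx' := by
    have a1 := H.fSmooth_minorant ρ hx hx'
    have a2 := mul_le_mul_of_nonneg_left (H.le_bregman hx hx') H.γ_pos.le
    simp only [bregman, add_apply, sub_apply, smul_apply, smul_eq_mul, map_sub] at a1 a2 ⊢
    linarith
  majorant x hx x' hx' := by
    have a1 := H.fSmooth_majorant hρ hx hx'
    have a2 := mul_le_mul_of_nonneg_left (H.bregman_le hx hx') H.γ_pos.le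
    -- Slack: `γ ω` contributes curvature `γβ`, whereas `L'_ρ` allows `λ⁻¹β = 2γβ`.
    have a3 : 0 ≤ c.γ * c.β / 2 * ‖x' - x‖ ^ 2 := by
      have := H.γ_pos
      have := H.β_pos
      positivity
    simp only [Constants.Lrho, Constants.lam_inv, bregman, add_apply, sub_apply, smul_apply,
      smul_eq_mul, map_sub] at a1 a2 ⊢
    linarith
  mu_pos := by rw [Constants.mu_eq]; exact H.γ_pos
  mu_le := by rw [Constants.mu_eq]; exact H.le_Lrho hρ
  exists_argmin G σ hσ d hd := by
    obtain ⟨-, Mr, hMr⟩ := H.lipschitz_r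
    suffices ∃ p ∈ P.𝒳, IsMinOn
        (fun u => P.r.val u + c.mu * P.ωX.val u + G u + σ * bregman P.ωX u d) P.𝒳 p by
      simpa using this
    refine exists_isMinOn_of_quadratic_minorant H.closed_𝒳 H.nonempty_𝒳 H.γ_pos fun x hx => ?_
    set l : X →L[ℝ] ℝ := (c.mu + σ) • fderiv ℝ P.ωX.val x + G - σ • fderiv ℝ P.ωX.val d with hl
    refine ⟨Mr + ‖l‖, fun x' hx' => ?_⟩
    have a2 := mul_le_mul_of_nonneg_left (H.le_bregman hx hx') H.γ_pos.le
    have a5 := mul_le_mul_of_nonneg_left ((by positivity : (0:ℝ) ≤ 1 / 2 * ‖x' - x‖ ^ 2).trans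
      (H.le_bregman hx hx')) hσ
    have a3 := (neg_abs_le (l (x' - x))).trans' (neg_le_neg (l.le_opNorm (x' - x)))
    have a4 := (abs_le.1 (hMr x' hx' x hx)).1
    simp only [hl, Constants.mu_eq, bregman, add_apply, sub_apply, smul_apply,
      smul_eq_mul, map_sub] at a2 a3 a4 a5 ⊢
    linarith

end Assumptions
end MinimaxProblem

/-! ### Estimates for the inner and outer loops -/

namespace MinimaxProblem

variable {X Y : Type*} [NormedAddCommGroup X] [NormedSpace ℝ X]
  [NormedAddCommGroup Y] [NormedSpace ℝ Y]

variable {P : MinimaxProblem X Y} {c : Constants} {A : X → ℝ → Y} {ε δ : ℝ}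

namespace Assumptions

theorem envSmooth_eq {ρ l : ℝ} {z p : X} (hp : p ∈ P.𝒳)
    (hmin : IsMinOn (fun x => P.QSmooth ρ l x z) P.𝒳 p) :
    P.envSmooth ρ l z = P.QSmooth ρ l p z :=
  IsLeast.csInf_eq ⟨mem_image_of_mem (fun x => P.QSmooth ρ l x z) hp,
    forall_mem_image.2 fun _ hx => hmin hx⟩

theorem qStar_le (H : P.Assumptions c) {x : X} (hx : x ∈ P.𝒳) : P.qStar ≤ P.q x :=
  csInf_le H.bddBelow_q (mem_image_of_mem _ hx)

theorem sq_le_of_QSmooth_le (H : P.Assumptions c) {z xp : X} (hz : z ∈ P.𝒳) (hxp : xp ∈ P.𝒳)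
    {s : ℝ} (h : P.QSmooth (P.rho c ε) c.lam xp z ≤ P.QSmooth (P.rho c ε) c.lam z z + s) :
    c.γ * ‖xp - z‖ ^ 2 ≤ (P.fSmooth (P.rho c ε) z + P.r.val z) -
      (P.fSmooth (P.rho c ε) xp + P.r.val xp) + s := by
  have h1 := mul_le_mul_of_nonneg_left (H.le_bregman hz hxp) H.γ_pos.le
  rw [QSmooth, QSmooth, bregman_self, Constants.lam_inv] at h
  linarith

/-- The reason for the value of `η`: two distances of `4√(λη)` add up to the target radius. -/
theorem sqrt_lam_mul_acc (H : P.Assumptions c) (hε : 0 < ε) :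
    8 * √(c.lam * c.acc ε) = ε * c.lam / c.β := by
  have := H.lam_pos
  have := H.β_pos
  rw [show c.lam * c.acc ε = (ε * c.lam / c.β / 8) ^ 2 by rw [Constants.acc]; ring,
    Real.sqrt_sq (by positivity)]
  ring

theorem le_sqrt_of_γ_mul_sq_le (H : P.Assumptions c) {a b : ℝ} (h : c.γ * a ^ 2 ≤ b) :
    a ≤ √(b / c.γ) := by
  refine Real.le_sqrt_of_sq_le ?_
  rw [le_div_iff₀ H.γ_pos]
  linarith

theorem run_mem {R : ℝ} {x u : ℕ → X} {N : ℕ → ℕ}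
    (hrun : P.IsRun c ε A δ R x u N) {k : ℕ} (hk : 1 ≤ k) :
    x k ∈ P.𝒳 := by
  obtain rfl | hk := hk.eq_or_lt
  · exact hrun.init.1
  · obtain ⟨k, rfl⟩ : ∃ j, k = j + 1 := ⟨k - 1, by omega⟩
    rw [hrun.next k (by omega)]
    exact (hrun.count k (by omega)).2.1.1.1

theorem run_stepTwo {R : ℝ} {x u : ℕ → X} {N : ℕ → ℕ}
    (hrun : P.IsRun c ε A δ R x u N) {k : ℕ} (hk : 1 ≤ k) :
    P.StepTwo c ε (x k) (x (k + 1)) := by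
  rw [hrun.next k hk]
  exact (hrun.count k hk).2.1

variable [FiniteDimensional ℝ Y]

/-! ### The inner method -/

theorem dual_oracle_sq_le (H : P.Assumptions c) {ρ : ℝ} (hρ : 0 < ρ) (hA : P.IsDualOracle ρ A)
    (hδ : 0 < δ) {x : X} (hx : x ∈ P.𝒳) : ‖A x δ - P.dualArgmax ρ x‖ ^ 2 ≤ 2 * δ / ρ := by
  obtain ⟨h1, h2⟩ := hA x hx δ hδ
  have h3 := H.phiD_add_sq_le hρ.le hx h1
  rw [le_div_iff₀ hρ]
  change P.fSmooth ρ x - _ ≤ δ at h2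
  linarith

/-- From `μ ≤ L'_ρ`, the factor `√L'_ρ (1 + √(L'_ρ/μ))²` is at least `4√μ`, so the admissible `δ`
satisfies `1568 δ Lxy² ≤ ηρμ`, the slope accuracy demanded by `apg_gap_le`. -/
theorem oracle_error_sq_le (H : P.Assumptions c) (hε : 0 < ε) (hδ : P.IsOracleAccuracy c ε δ) :
    784 * (c.Lxy * √(2 * δ / P.rho c ε)) ^ 2 ≤ c.acc ε * c.mu := by
  obtain ⟨hδ0, hδ⟩ := hδ
  have hρ := H.rho_pos hε
  have hμ : 0 < c.mu := by rw [Constants.mu_eq]; exact H.γ_pos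
  have hμL : c.mu ≤ c.Lrho (P.rho c ε) := by rw [Constants.mu_eq]; exact H.le_Lrho hρ
  set L := c.Lrho (P.rho c ε)
  have hs : 0 < √c.mu := Real.sqrt_pos.2 hμ
  have h1 : √c.mu ≤ √L := Real.sqrt_le_sqrt hμL
  have h2 : 1 ≤ √(L / c.mu) := by rw [Real.one_le_sqrt, one_le_div hμ]; exact hμL
  have h3 : (14 * √2) ^ 2 = (392 : ℝ) := by rw [mul_pow, Real.sq_sqrt (by norm_num)]; norm_num
  have h4 : c.mu ^ (3 / 2 : ℝ) = c.mu * √c.mu := by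
    rw [show (3 / 2 : ℝ) = 1 + 1 / 2 by norm_num, Real.rpow_add hμ, Real.rpow_one,
      Real.sqrt_eq_rpow]
  rw [h3, h4] at hδ
  have h5 : √c.mu * 4 ≤ √L * (1 + √(L / c.mu)) ^ 2 :=
    mul_le_mul h1 (by nlinarith) (by norm_num) (Real.sqrt_nonneg _)
  have h6 : 1568 * δ * c.Lxy ^ 2 * √c.mu ≤ c.acc ε * P.rho c ε * c.mu * √c.mu := by
    have := mul_le_mul_of_nonneg_left h5 (show 0 ≤ δ * (392 * c.Lxy ^ 2) by positivity)
    linarith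
  have h7 := le_of_mul_le_mul_right h6 hs
  rw [mul_pow, Real.sq_sqrt (by positivity)]
  have e : 784 * (c.Lxy ^ 2 * (2 * δ / P.rho c ε)) = 1568 * δ * c.Lxy ^ 2 / P.rho c ε := by ring
  rw [e, div_le_iff₀ hρ]
  linarith

theorem norm_inexactGrad_sub_le (H : P.Assumptions c) {ρ : ℝ} (hρ : 0 < ρ)
    (hA : P.IsDualOracle ρ A) (hδ : 0 < δ) (z : X) {x : X} (hx : x ∈ P.𝒳) :
    ‖P.inexactGrad c A δ z x - (c.γ • fderiv ℝ P.ωX.val x +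
      P.primalOracle x (P.dualArgmax ρ x) - c.lam⁻¹ • fderiv ℝ P.ωX.val z)‖ ≤
      c.Lxy * √(2 * δ / ρ) := by
  have e : P.inexactGrad c A δ z x - (c.γ • fderiv ℝ P.ωX.val x +
      P.primalOracle x (P.dualArgmax ρ x) - c.lam⁻¹ • fderiv ℝ P.ωX.val z) =
      P.primalOracle x (A x δ) - P.primalOracle x (P.dualArgmax ρ x) := by
    rw [inexactGrad]; abel
  rw [e]
  refine (H.Lxy_bound x hx _ (hA x hx δ hδ).1 _ (H.dualArgmax_spec ρ hx).1).trans ?_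
  exact mul_le_mul_of_nonneg_left (Real.le_sqrt_of_sq_le (H.dual_oracle_sq_le hρ hA hδ hx))
    H.Lxy_nonneg

variable [FiniteDimensional ℝ X]

/-- The inner method completes Step 2 after sufficiently many iterations. -/
theorem stepTwo_innerOutput (H : P.Assumptions c) (hε : 0 < ε)
    (hA : P.IsDualOracle (P.rho c ε) A) (hδ : P.IsOracleAccuracy c ε δ) {z u₀ p : X}
    (hu₀ : u₀ ∈ P.𝒳) (hp : p ∈ P.𝒳)
    (hmin : IsMinOn (fun x => P.QSmooth (P.rho c ε) c.lam x z) P.𝒳 p) {t : ℕ} (ht : 1 ≤ t)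
    (hlog : 4 * (1 + √(c.Lrho (P.rho c ε) / c.mu)) *
      Real.log (12 * ((c.mu * c.β / 2 + c.Lrho (P.rho c ε)) * ‖u₀ - p‖ ^ 2) / c.acc ε + 2 +
        4 * c.Lrho (P.rho c ε) / c.mu) ≤ t) :
    P.StepTwo c ε z (P.innerOutput c ε A δ z u₀ t) := by
  have hρ := H.rho_pos hε
  have hmin' := hmin
  simp only [P.QSmooth_eq c] at hmin'
  have h := apg_gap_le (H.compositeModel hρ z) H.β_pos.le
    (mul_nonneg H.Lxy_nonneg (Real.sqrt_nonneg _))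
    (fun x hx => H.norm_inexactGrad_sub_le hρ hA hδ.1 z hx) hu₀ hp hmin' (H.acc_pos hε)
    (H.oracle_error_sq_le hε hδ) ht hlog
  rw [StepTwo, H.relDom_eq, envSmooth_eq hp hmin, P.QSmooth_eq c, P.QSmooth_eq c]
  exact h

theorem exists_isStepTwoCount (H : P.Assumptions c) (hε : 0 < ε)
    (hA : P.IsDualOracle (P.rho c ε) A) (hδ : P.IsOracleAccuracy c ε δ) (z : X) {u₀ : X}
    (hu₀ : u₀ ∈ P.𝒳) : ∃ n, P.IsStepTwoCount c ε A δ z u₀ n := by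
  classical
  obtain ⟨p, hp, hmin⟩ := H.exists_isMinOn_QSmooth (P.rho c ε) z
  obtain ⟨n, hn⟩ := exists_nat_ge (4 * (1 + √(c.Lrho (P.rho c ε) / c.mu)) *
      Real.log (12 * ((c.mu * c.β / 2 + c.Lrho (P.rho c ε)) * ‖u₀ - p‖ ^ 2) / c.acc ε + 2 +
        4 * c.Lrho (P.rho c ε) / c.mu))
  have hex : ∃ n, 1 ≤ n ∧ P.StepTwo c ε z (P.innerOutput c ε A δ z u₀ n) :=
    ⟨n + 1, by omega, H.stepTwo_innerOutput hε hA hδ hu₀ hp hmin (by omega)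
      (hn.trans (by push_cast; linarith))⟩
  exact ⟨Nat.find hex, (Nat.find_spec hex).1, (Nat.find_spec hex).2,
    fun t ht htn h => Nat.find_min hex htn ⟨ht, h⟩⟩

/-- By minimality of `n`, the output after `n - 1` iterations is not acceptable, so `n - 1` is below
the sufficient number; this is the `+ 1`. -/
theorem isStepTwoCount_le (H : P.Assumptions c) (hε : 0 < ε)
    (hA : P.IsDualOracle (P.rho c ε) A) (hδ : P.IsOracleAccuracy c ε δ) {z u₀ p : X}
    (hu₀ : u₀ ∈ P.𝒳) (hp : p ∈ P.𝒳)
    (hmin : IsMinOn (fun x => P.QSmooth (P.rho c ε) c.lam x z) P.𝒳 p) {n : ℕ}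
    (hn : P.IsStepTwoCount c ε A δ z u₀ n) {B T : ℝ} (hB : ‖u₀ - p‖ ≤ B)
    (hT : 4 * (1 + √(c.Lrho (P.rho c ε) / c.mu)) *
      Real.log (12 * ((c.mu * c.β / 2 + c.Lrho (P.rho c ε)) * B ^ 2) / c.acc ε + 2 +
        4 * c.Lrho (P.rho c ε) / c.mu) ≤ T) :
    (n : ℝ) ≤ T + 1 := by
  have hμ : 0 < c.mu := by rw [Constants.mu_eq]; exact H.γ_pos
  have hL : 0 < c.Lrho (P.rho c ε) := H.γ_pos.trans_le (H.le_Lrho (H.rho_pos hε))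
  have hη := H.acc_pos hε
  have hβ := H.β_pos
  have hlog : 4 * (1 + √(c.Lrho (P.rho c ε) / c.mu)) *
      Real.log (12 * ((c.mu * c.β / 2 + c.Lrho (P.rho c ε)) * ‖u₀ - p‖ ^ 2) / c.acc ε + 2 +
        4 * c.Lrho (P.rho c ε) / c.mu) ≤ T := by
    refine le_trans ?_ hT
    gcongr
  have hT0 : 0 ≤ T := by
    refine le_trans (mul_nonneg (by positivity) (Real.log_nonneg ?_)) hT
    have h1 : 0 ≤ 12 * ((c.mu * c.β / 2 + c.Lrho (P.rho c ε)) * B ^ 2) / c.acc ε := by positivity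
    have h2 : 0 ≤ 4 * c.Lrho (P.rho c ε) / c.mu := by positivity
    linarith
  by_contra! hlt
  have h1 : 1 < n := by
    have : (1 : ℝ) < n := by linarith
    exact_mod_cast this
  refine hn.2.2 (n - 1) (by omega) (by omega) (H.stepTwo_innerOutput hε hA hδ hu₀ hp hmin
    (by omega) (hlog.trans ?_))
  rw [Nat.cast_sub h1.le, Nat.cast_one]
  linarith

/-! ### The outer loop -/


theorem stepTwo_sq_le (H : P.Assumptions c) {z xp : X} (hz : z ∈ P.𝒳)
    (h : P.StepTwo c ε z xp) :
    c.γ * ‖xp - z‖ ^ 2 ≤ (P.fSmooth (P.rho c ε) z + P.r.val z) -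
      (P.fSmooth (P.rho c ε) xp + P.r.val xp) + c.acc ε := by
  obtain ⟨p, hp, hmin⟩ := H.exists_isMinOn_QSmooth (P.rho c ε) z
  have h2 := h.2
  rw [envSmooth_eq hp hmin] at h2
  exact H.sq_le_of_QSmooth_le hz h.1.1 (h2.trans (add_le_add_left (hmin hz) _))

theorem qSmooth_sub_le (H : P.Assumptions c) (hε : 0 < ε) {x x' : X} (hx : x ∈ P.𝒳)
    (hx' : x' ∈ P.𝒳) :
    (P.fSmooth (P.rho c ε) x + P.r.val x) - (P.fSmooth (P.rho c ε) x' + P.r.val x') ≤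
      P.q x - P.qStar + c.acc ε / 2 := by
  have h1 := abs_le.1 (H.abs_fSmooth_sub_f_le hε hx)
  have h2 := abs_le.1 (H.abs_fSmooth_sub_f_le hε hx')
  have h3 := H.qStar_le hx'
  rw [q] at h3 ⊢
  linarith

/-- The point `xp` is nearly optimal for the unsmoothed proximal problem, so strong convexity puts
it near the proximal point, and the stopping test puts it near `z`. -/
theorem isNearStationary_of_stepTwo (H : P.Assumptions c) (hε : 0 < ε) {z xp : X} (hz : z ∈ P.𝒳)
    (h : P.StepTwo c ε z xp) (hterm : ‖xp - z‖ ≤ 4 * √(c.lam * c.acc ε)) :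
    P.IsNearStationary c.β ε c.lam z := by
  have hQ : ∀ x, P.Q c.lam x z = P.QSmooth 0 c.lam x z := fun x => (QSmooth_zero _ _ _).symm
  have hgrow : ∀ p, P.IsProx c.lam z p → ∀ x ∈ P.𝒳,
      P.QSmooth 0 c.lam p z + c.γ / 2 * ‖x - p‖ ^ 2 ≤ P.QSmooth 0 c.lam x z := fun p hp x hx => by
    have := hp.2
    simp only [hQ] at this
    exact (H.strongConvexOn_QSmooth 0 z).add_sq_le_of_isMinOn hp.1 this hx
  have hγ := H.γ_pos
  refine ⟨hz, ?_, fun p hp => ?_⟩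
  · obtain ⟨p, hp, hmin⟩ := H.exists_isMinOn_QSmooth 0 z
    have hpp : P.IsProx c.lam z p := ⟨hp, by simpa only [hQ] using hmin⟩
    refine ⟨p, hpp, fun p' hp' => ?_⟩
    have h1 := hgrow p hpp p' hp'.1
    have h2 := hgrow p' hp' p hp
    have h3 : c.γ / 2 * ‖p' - p‖ ^ 2 ≤ 0 := by
      have : 0 ≤ c.γ / 2 * ‖p - p'‖ ^ 2 := by positivity
      linarith
    have h4 : ‖p' - p‖ ^ 2 ≤ 0 := nonpos_of_mul_nonpos_right h3 (half_pos hγ)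
    exact sub_eq_zero.1 (norm_eq_zero.1 (pow_eq_zero_iff two_ne_zero |>.1
      (le_antisymm h4 (sq_nonneg _))))
  · have hxp := h.1.1
    have h1 := hgrow p hp xp hxp
    obtain ⟨p', hp', hmin⟩ := H.exists_isMinOn_QSmooth (P.rho c ε) z
    have h2 := h.2
    rw [envSmooth_eq hp' hmin] at h2
    have h3 : P.QSmooth (P.rho c ε) c.lam p' z ≤ P.QSmooth (P.rho c ε) c.lam p z := hmin hp.1
    have h4 := abs_le.1 (H.abs_fSmooth_sub_f_le hε hxp)
    have h5 := abs_le.1 (H.abs_fSmooth_sub_f_le hε hp.1)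
    -- Step 2 tolerance `η`, plus smoothing error `η/4` at each of `xp` and `p`.
    have h6 : c.γ / 2 * ‖xp - p‖ ^ 2 ≤ 3 / 2 * c.acc ε := by
      rw [QSmooth, QSmooth, fSmooth_zero] at h1
      simp only [QSmooth] at h2 h3
      linarith
    have h7 : ‖xp - p‖ ≤ 4 * √(c.lam * c.acc ε) := by
      have hla : 0 ≤ c.lam * c.acc ε := (mul_pos H.lam_pos (H.acc_pos hε)).le
      refine le_of_sq_le_sq ?_ (by positivity)
      rw [mul_pow, Real.sq_sqrt hla]
      have e : c.lam * c.acc ε = c.acc ε / (2 * c.γ) := by rw [Constants.lam]; ring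
      rw [e, mul_div_assoc', le_div_iff₀ (by positivity)]
      linarith [H.acc_pos hε]
    have h8 := norm_sub_le (xp - p) (xp - z)
    rw [sub_sub_sub_cancel_left] at h8
    rw [← H.sqrt_lam_mul_acc hε]
    linarith

section Run

variable {R : ℝ} {x u : ℕ → X} {N : ℕ → ℕ}

/-- A non-stopping step has `γ‖x (k+1) - x k‖² ≥ 16γλη = 8η`, of which the inexactness of Step 2
takes back `η`. -/
theorem run_decrease (H : P.Assumptions c) (hε : 0 < ε) (hrun : P.IsRun c ε A δ R x u N) {k : ℕ}
    (hk : 1 ≤ k) (hns : ∀ i, 1 ≤ i → i < k → ¬ c.Stops ε x i) :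
    (P.fSmooth (P.rho c ε) (x k) + P.r.val (x k)) + 7 * c.acc ε * (k - 1) ≤
      P.fSmooth (P.rho c ε) (x 1) + P.r.val (x 1) := by
  induction k, hk using Nat.le_induction with
  | base => simp
  | succ k hk ih =>
    have h1 := ih fun i hi hik => hns i hi (by omega)
    have h2 := H.stepTwo_sq_le (run_mem hrun hk) (run_stepTwo hrun hk)
    have h3 := hns k hk (by omega)
    rw [Constants.Stops, not_le] at h3
    have hla : 0 ≤ c.lam * c.acc ε := (mul_pos H.lam_pos (H.acc_pos hε)).le
    have h4 : (4 * √(c.lam * c.acc ε)) ^ 2 ≤ ‖x (k + 1) - x k‖ ^ 2 :=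
      pow_le_pow_left₀ (by positivity) h3.le 2
    rw [mul_pow, Real.sq_sqrt hla] at h4
    have h5 := mul_le_mul_of_nonneg_left h4 H.γ_pos.le
    have e : c.γ * (4 ^ 2 * (c.lam * c.acc ε)) = 8 * c.acc ε := by
      have := H.γ_pos
      rw [Constants.lam]; field_simp; ring
    rw [e] at h5
    push_cast
    linarith

theorem run_length_le (H : P.Assumptions c) (hε : 0 < ε) (hrun : P.IsRun c ε A δ R x u N)
    {Δ : ℝ} (hΔ : P.q (x 1) - P.qStar ≤ Δ) {k : ℕ} (hk : 1 ≤ k)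
    (hns : ∀ i, 1 ≤ i → i < k → ¬ c.Stops ε x i) : (k : ℝ) ≤ 2 + Δ / (7 * c.acc ε) := by
  have hη := H.acc_pos hε
  have h1 := H.run_decrease hε hrun hk hns
  have h2 := H.qSmooth_sub_le hε (run_mem hrun le_rfl) (run_mem hrun hk)
  rw [← sub_le_iff_le_add', le_div_iff₀ (by positivity)]
  linarith

theorem exists_first_termination (H : P.Assumptions c) (hε : 0 < ε) (hrun : P.IsRun c ε A δ R x u N) :
    ∃ K, 1 ≤ K ∧ c.Stops ε x K ∧ ∀ k, 1 ≤ k → k < K → ¬ c.Stops ε x k := by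
  classical
  have hex : ∃ K, 1 ≤ K ∧ c.Stops ε x K := by
    by_contra! hcon
    obtain ⟨n, hn⟩ := exists_nat_gt (2 + (P.q (x 1) - P.qStar) / (7 * c.acc ε))
    have := H.run_length_le hε hrun le_rfl (k := n + 1) (by omega) fun i hi _ => hcon i hi
    push_cast at this
    linarith
  exact ⟨Nat.find hex, (Nat.find_spec hex).1, (Nat.find_spec hex).2,
    fun k hk hkK h => Nat.find_min hex hkK ⟨hk, h⟩⟩

theorem run_qSmooth_le (H : P.Assumptions c) (hε : 0 < ε) (hrun : P.IsRun c ε A δ R x u N)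
    {Δ : ℝ} (hΔ : P.q (x 1) - P.qStar ≤ Δ) {k : ℕ} (hk : 1 ≤ k)
    (hns : ∀ i, 1 ≤ i → i < k → ¬ c.Stops ε x i) {x' : X} (hx' : x' ∈ P.𝒳) :
    (P.fSmooth (P.rho c ε) (x k) + P.r.val (x k)) - (P.fSmooth (P.rho c ε) x' + P.r.val x') ≤
      Δ + c.acc ε / 2 := by
  have h1 := H.run_decrease hε hrun hk hns
  have h2 := H.qSmooth_sub_le hε (run_mem hrun le_rfl) hx'
  have h3 : 0 ≤ 7 * c.acc ε * ((k : ℝ) - 1) := by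
    have : (1 : ℝ) ≤ k := by exact_mod_cast hk
    have := H.acc_pos hε
    exact mul_nonneg (by positivity) (by linarith)
  linarith

/-- Each step is bounded through the remaining objective gap, and the triangle inequality sums them.
This handles inner starts chosen near an old iterate. -/
theorem run_dist_le (H : P.Assumptions c) (hε : 0 < ε) (hrun : P.IsRun c ε A δ R x u N)
    {Δ : ℝ} (hΔ : P.q (x 1) - P.qStar ≤ Δ) {j k : ℕ} (hj : 1 ≤ j) (hjk : j ≤ k)
    (hns : ∀ i, 1 ≤ i → i < k → ¬ c.Stops ε x i) :
    ‖x k - x j‖ ≤ (k - j) * √((Δ + 2 * c.acc ε) / c.γ) := by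
  induction k, hjk using Nat.le_induction with
  | base => simp
  | succ k hk ih =>
    have hns' : ∀ i, 1 ≤ i → i < k → ¬ c.Stops ε x i := fun i hi hik => hns i hi (by omega)
    have h1 := ih hns'
    have h2 := H.stepTwo_sq_le (run_mem hrun (hj.trans hk)) (run_stepTwo hrun (hj.trans hk))
    have h3 := H.run_qSmooth_le hε hrun hΔ (hj.trans hk) hns'
      (run_mem hrun (k := k + 1) (by omega))
    have h4 : ‖x (k + 1) - x k‖ ≤ √((Δ + 2 * c.acc ε) / c.γ) :=
      H.le_sqrt_of_γ_mul_sq_le (by linarith [H.acc_pos hε])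
    have h5 := norm_add_le (x (k + 1) - x k) (x k - x j)
    rw [sub_add_sub_cancel] at h5
    push_cast
    linarith

/-- Bound on the number of primal oracle calls in the outer iterations up to the first stop. -/
theorem totalCalls_le (H : P.Assumptions c) (hε : 0 < ε)
    (hA : P.IsDualOracle (P.rho c ε) A) (hδ : P.IsOracleAccuracy c ε δ)
    (hrun : P.IsRun c ε A δ R x u N)
    {Δ : ℝ} (hΔ : P.q (x 1) - P.qStar ≤ Δ) {K : ℕ} (hK : 1 ≤ K)
    (hns : ∀ i, 1 ≤ i → i < K → ¬ c.Stops ε x i) {κ L' : ℝ} (hκ : 2 + Δ / (7 * c.acc ε) ≤ κ)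
    (hL' : c.Lrho (P.rho c ε) ≤ L') :
    (P.totalCalls c ε A δ x u N K : ℝ) ≤ κ * (4 * (1 + √(L' / c.γ)) *
      Real.log (12 * ((c.γ * c.β / 2 + L') *
        (|R| + κ * √((Δ + 2 * c.acc ε) / c.γ)) ^ 2) / c.acc ε + 2 + 4 * L' / c.γ) + 1) := by
  set D := √((Δ + 2 * c.acc ε) / c.γ)
  have hD : 0 ≤ D := Real.sqrt_nonneg _
  have hKκ : (K : ℝ) ≤ κ := (H.run_length_le hε hrun hΔ hK hns).trans hκ
  have hκ0 : 0 ≤ κ := (Nat.cast_nonneg K).trans hKκ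
  have hγ := H.γ_pos
  have hη := H.acc_pos hε
  have hβ := H.β_pos
  have hL : 0 < c.Lrho (P.rho c ε) := H.γ_pos.trans_le (H.le_Lrho (H.rho_pos hε))
  have hL'0 : 0 < L' := hL.trans_le hL'
  set T := 4 * (1 + √(L' / c.γ)) *
      Real.log (12 * ((c.γ * c.β / 2 + L') *
        (|R| + κ * D) ^ 2) / c.acc ε + 2 + 4 * L' / c.γ) with hT
  have hT0 : 0 ≤ T := by
    refine mul_nonneg (by positivity) (Real.log_nonneg ?_)
    have h1 : 0 ≤ 12 * ((c.γ * c.β / 2 + L') * (|R| + κ * D) ^ 2) / c.acc ε := by positivity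
    have h2 : 0 ≤ 4 * L' / c.γ := by positivity
    linarith
  have hN : ∀ k ∈ Finset.Icc 1 K,
      ((P.innerState c ε A δ (x k) (u k) (N k)).calls : ℝ) ≤ T + 1 := fun k hk => by
    obtain ⟨hk1, hkK⟩ := Finset.mem_Icc.1 hk
    have hcalls : (P.innerState c ε A δ (x k) (u k) (N k)).calls = N k :=
      apgState_calls _ _ _ _ _ _ _ _ _ _
    rw [hcalls]
    have hns' : ∀ i, 1 ≤ i → i < k → ¬ c.Stops ε x i := fun i hi hik => hns i hi (by omega)
    have hxk := run_mem hrun hk1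
    obtain ⟨p, hp, hmin⟩ := H.exists_isMinOn_QSmooth (P.rho c ε) (x k)
    obtain ⟨j, hj1, hjk, hj⟩ := hrun.start_near k hk1
    have h1 := H.run_dist_le hε hrun hΔ hj1 hjk hns'
    have h2 : ‖p - x k‖ ≤ D := by
      refine H.le_sqrt_of_γ_mul_sq_le ?_
      have a1 := H.sq_le_of_QSmooth_le (s := 0) hxk hp (by rw [add_zero]; exact hmin hxk)
      have a2 := H.run_qSmooth_le hε hrun hΔ hk1 hns' hp
      linarith
    -- Through `x j` and `x k`: at most `κ - 1` outer steps of length `D`, and one more `D` from `x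
    -- k` to the minimizer.
    have h3 : ‖u k - p‖ ≤ |R| + κ * D := by
      have e : u k - p = (u k - x j) - (x k - x j) - (p - x k) := by abel
      have a1 := norm_sub_le ((u k - x j) - (x k - x j)) (p - x k)
      have a2 := norm_sub_le (u k - x j) (x k - x j)
      have a3 : ((k : ℝ) - j) * D ≤ (κ - 1) * D := by
        refine mul_le_mul_of_nonneg_right ?_ hD
        have : (k : ℝ) ≤ K := by exact_mod_cast hkK
        have : (1 : ℝ) ≤ j := by exact_mod_cast hj1
        linarith
      rw [e]
      linarith [le_abs_self R]
    refine H.isStepTwoCount_le hε hA hδ (hrun.start_mem k hk1).1 hp hmin (hrun.count k hk1) h3 ?_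
    rw [hT, Constants.mu_eq]
    gcongr
    refine Real.log_nonneg ?_
    have h1 : 0 ≤ 12 * ((c.γ * c.β / 2 + c.Lrho (P.rho c ε)) * (|R| + κ * D) ^ 2) / c.acc ε := by
      positivity
    have h2 : 0 ≤ 4 * c.Lrho (P.rho c ε) / c.γ := by positivity
    linarith
  rw [totalCalls, Nat.cast_sum]
  refine (Finset.sum_le_card_nsmul _ _ _ hN).trans ?_
  rw [Nat.card_Icc, Nat.add_sub_cancel, nsmul_eq_mul]
  exact mul_le_mul_of_nonneg_right hKκ (by linarith)

end Run

end Assumptions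
end MinimaxProblem

/-! ### Asymptotics of the explicit call count -/

theorem log_le_of_le_mul_inv_pow {M M' ε : ℝ} (hM : 0 < M) (hε : 0 < ε)
    (hM' : M ≤ M' / ε ^ 8) (hεM : M' * ε ≤ 1) : Real.log M ≤ 9 * Real.log (1 / ε) := by
  have h1 : M ≤ (1 / ε) ^ 9 := by
    refine hM'.trans ?_
    rw [div_le_iff₀ (by positivity)]
    have : (1 / ε) ^ 9 * ε ^ 8 = 1 / ε := by field_simp
    rw [this, le_div_iff₀ hε]
    exact hεM
  have h2 := Real.log_le_log hM h1
  rwa [Real.log_pow] at h2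

/-- The explicit bound on the number of calls has the claimed order. -/
theorem complexity_bound {β Ω Δ γ Lxx Lxy : ℝ} (R : ℝ) (hβ : 1 ≤ β) (hΩ : 0 < Ω) (hΔ : 0 ≤ Δ)
    (hγ : 0 < γ) (hγL : γ ≤ Lxx) (hLxy : 0 ≤ Lxy) :
    ∃ ε₀ : ℝ, 0 < ε₀ ∧ ∀ ε η κ L : ℝ, 0 < ε → ε ≤ ε₀ → η = ε ^ 2 / (128 * γ * β ^ 2) →
      κ = 2 + Δ / (7 * η) → L = Lxx + 2 * γ * β + Lxy ^ 2 * (4 * Ω / η) →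
      κ * (4 * (1 + √(L / γ)) * Real.log (12 * ((γ * β / 2 + L) *
        (|R| + κ * √((Δ + 2 * η) / γ)) ^ 2) / η + 2 + 4 * L / γ) + 1) ≤
      40 * (1 + 19 * β ^ 2 * Δ) * (1 + 23 * β * √Ω) *
        (γ * (√Lxx + Lxy) * (1 / ε) ^ 3 * Real.log (1 / ε)) := by
  have hβ0 : 0 < β := one_pos.trans_le hβ
  have hLxx : 0 < Lxx := hγ.trans_le hγL
  -- Subscript `1` marks the quantities at `ε = 1`; for `ε ≤ 1` the others are bounded by these
  -- times inverse powers of `ε`.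
  set η₁ := 1 / (128 * γ * β ^ 2) with hη₁
  have hη₁0 : 0 < η₁ := by positivity
  set L₁ := Lxx + 2 * γ * β + Lxy ^ 2 * (4 * Ω / η₁) with hL₁
  have hL₁0 : 0 < L₁ := by positivity
  set κ₁ := 2 + Δ / (7 * η₁) with hκ₁
  have hκ₁0 : 0 < κ₁ := by positivity
  set D₁ := √((Δ + 2 * η₁) / γ) with hD₁
  set M₁ := 12 * ((γ * β / 2 + L₁) * (|R| + κ₁ * D₁) ^ 2) / η₁ + 2 + 4 * L₁ / γ with hM₁
  have hM₁0 : 0 < M₁ := by positivity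
  set s := 1 + √(Lxx / γ + 2 * β)
  have hs : 0 < s := by positivity
  -- The four thresholds absorb the constants inside the logarithm, ensure `log (1/ε) ≥ 1`, ensure
  -- `2ε² ≤ γ`, and make the part of `1 + √(L/γ)` that does not grow like `1/ε` at most `√Lxx/ε`.
  refine ⟨min (min (1 / M₁) (Real.exp (-1))) (min (√(γ / 2)) (√Lxx / s)), by positivity, ?_⟩
  intro ε η κ L hε hε₀ hη hκ hL
  have hεM : M₁ * ε ≤ 1 := by
    have : ε ≤ 1 / M₁ := hε₀.trans ((min_le_left _ _).trans (min_le_left _ _))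
    rw [le_div_iff₀ hM₁0] at this
    linarith
  have hεe : ε ≤ Real.exp (-1) := hε₀.trans ((min_le_left _ _).trans (min_le_right _ _))
  have hεγ : 2 * ε ^ 2 ≤ γ := by
    have : ε ≤ √(γ / 2) := hε₀.trans ((min_le_right _ _).trans (min_le_left _ _))
    have := pow_le_pow_left₀ hε.le this 2
    rw [Real.sq_sqrt (by positivity)] at this
    linarith
  have hεs : ε * s ≤ √Lxx := by
    have : ε ≤ √Lxx / s := hε₀.trans ((min_le_right _ _).trans (min_le_right _ _))
    rwa [le_div_iff₀ hs] at this
  have hlog : 1 ≤ Real.log (1 / ε) := by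
    have := Real.log_le_log hε hεe
    rw [Real.log_exp] at this
    rw [one_div, Real.log_inv]
    linarith
  have hε1 : ε ≤ 1 := hεe.trans (Real.exp_le_one_iff.2 (by norm_num))
  have hη' : η = η₁ * ε ^ 2 := by rw [hη, hη₁]; ring
  have hη0 : 0 < η := by rw [hη']; positivity
  have hκ0 : 0 < κ := by rw [hκ]; positivity
  have hL0 : 0 < L := by rw [hL]; positivity
  have hp2 : ε ^ 2 ≤ 1 := pow_le_one₀ hε.le hε1
  have hLL : L ≤ L₁ / ε ^ 2 := by
    rw [le_div_iff₀ (by positivity), hL, hL₁, hη']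
    have e : Lxy ^ 2 * (4 * Ω / (η₁ * ε ^ 2)) * ε ^ 2 = Lxy ^ 2 * (4 * Ω / η₁) := by field_simp
    rw [add_mul, e]
    have : (Lxx + 2 * γ * β) * ε ^ 2 ≤ (Lxx + 2 * γ * β) * 1 :=
      mul_le_mul_of_nonneg_left hp2 (by positivity)
    linarith
  have hκκ : κ ≤ κ₁ / ε ^ 2 := by
    rw [le_div_iff₀ (by positivity), hκ, hκ₁, hη']
    have e : Δ / (7 * (η₁ * ε ^ 2)) * ε ^ 2 = Δ / (7 * η₁) := by field_simp
    rw [add_mul, e]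
    linarith
  have hDD : √((Δ + 2 * η) / γ) ≤ D₁ := by
    have : η ≤ η₁ := by rw [hη']; exact mul_le_of_le_one_right hη₁0.le hp2
    exact Real.sqrt_le_sqrt (by gcongr)
  set M := 12 * ((γ * β / 2 + L) * (|R| + κ * √((Δ + 2 * η) / γ)) ^ 2) / η + 2 + 4 * L / γ
    with hM
  have hMpos : 0 < M := by positivity
  -- The exponent collects `ε⁻²` from `L`, `ε⁻⁴` from the squared distance and `ε⁻²` from `1/η`.
  have hMM : M ≤ M₁ / ε ^ 8 := by
    have a1 : |R| + κ * √((Δ + 2 * η) / γ) ≤ (|R| + κ₁ * D₁) / ε ^ 2 := by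
      have b1 : κ * √((Δ + 2 * η) / γ) ≤ κ₁ / ε ^ 2 * D₁ :=
        mul_le_mul hκκ hDD (Real.sqrt_nonneg _) (by positivity)
      have b2 : |R| ≤ |R| / ε ^ 2 := le_div_self (abs_nonneg R) (by positivity) hp2
      rw [add_div |R|, mul_div_right_comm]
      linarith
    have a2 : γ * β / 2 + L ≤ (γ * β / 2 + L₁) / ε ^ 2 := by
      have b2 : γ * β / 2 ≤ γ * β / 2 / ε ^ 2 := le_div_self (by positivity) (by positivity) hp2
      rw [add_div]
      linarith
    have a3 : 12 * ((γ * β / 2 + L) * (|R| + κ * √((Δ + 2 * η) / γ)) ^ 2) / η ≤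
        12 * ((γ * β / 2 + L₁) * (|R| + κ₁ * D₁) ^ 2) / η₁ / ε ^ 8 := by
      have b : 12 * ((γ * β / 2 + L) * (|R| + κ * √((Δ + 2 * η) / γ)) ^ 2) / η ≤
          12 * ((γ * β / 2 + L₁) / ε ^ 2 * ((|R| + κ₁ * D₁) / ε ^ 2) ^ 2) / η := by gcongr
      refine b.trans (le_of_eq ?_)
      rw [hη']
      field_simp
    have a4 : 2 ≤ 2 / ε ^ 8 := le_div_self (by norm_num) (by positivity) (pow_le_one₀ hε.le hε1)
    have a5 : 4 * L / γ ≤ 4 * L₁ / γ / ε ^ 8 := by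
      have : L ≤ L₁ / ε ^ 8 := hLL.trans
        (div_le_div_of_nonneg_left hL₁0.le (by positivity)
          (pow_le_pow_of_le_one hε.le hε1 (by norm_num)))
      calc 4 * L / γ ≤ 4 * (L₁ / ε ^ 8) / γ := by gcongr
        _ = _ := by ring
    rw [hM, hM₁, add_div _ (4 * L₁ / γ) (ε ^ 8), add_div _ 2 (ε ^ 8)]
    linarith
  have hlogM := log_le_of_le_mul_inv_pow hMpos hε hMM hεM
  set ℓ := Real.log (1 / ε)
  set τ := √(L / γ) with hτ
  have hτ0 : 0 ≤ τ := Real.sqrt_nonneg _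
  -- The constant `19` rounds up `128/7`.
  have hκb : κ * ε ^ 2 ≤ γ * (1 + 19 * β ^ 2 * Δ) := by
    rw [hκ, hη]
    have e : (2 + Δ / (7 * (ε ^ 2 / (128 * γ * β ^ 2)))) * ε ^ 2 =
      2 * ε ^ 2 + 128 / 7 * (γ * β ^ 2 * Δ) := by field_simp
    rw [e]
    have : 0 ≤ γ * β ^ 2 * Δ := by positivity
    linarith
  -- The `Lxy` part of `L/γ` is `512 β²Ω Lxy²/ε²`, and `512 ≤ 23²`.
  have hτb : (1 + τ) * ε ≤ (1 + 23 * β * √Ω) * (√Lxx + Lxy) := by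
    have a1 : τ ≤ √(Lxx / γ + 2 * β) + 23 * β * √Ω * Lxy / ε := by
      rw [hτ, Real.sqrt_le_iff]
      refine ⟨by positivity, ?_⟩
      have b1 : (√(Lxx / γ + 2 * β)) ^ 2 = Lxx / γ + 2 * β := Real.sq_sqrt (by positivity)
      have b2 : (23 * β * √Ω * Lxy / ε) ^ 2 = 529 * (β ^ 2 * Ω * Lxy ^ 2 / ε ^ 2) := by
        rw [div_pow, mul_pow, mul_pow, mul_pow, Real.sq_sqrt hΩ.le]; ring
      have b3 : L / γ = Lxx / γ + 2 * β + 512 * (β ^ 2 * Ω * Lxy ^ 2 / ε ^ 2) := by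
        rw [hL, hη]; field_simp; ring
      have b4 : 0 ≤ √(Lxx / γ + 2 * β) * (23 * β * √Ω * Lxy / ε) := by positivity
      have b5 : 0 ≤ β ^ 2 * Ω * Lxy ^ 2 / ε ^ 2 := by positivity
      rw [add_sq, b1, b2, b3]
      linarith
    have a2 : (1 + τ) * ε ≤ (s + 23 * β * √Ω * Lxy / ε) * ε :=
      mul_le_mul_of_nonneg_right (by linarith) hε.le
    have e : (s + 23 * β * √Ω * Lxy / ε) * ε = ε * s + 23 * β * √Ω * Lxy := by field_simp
    have a3 : 0 ≤ 23 * β * √Ω * √Lxx := by positivity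
    rw [e] at a2
    linarith
  have h1 : 4 * (1 + τ) * Real.log M + 1 ≤ 40 * ((1 + τ) * ℓ) := by
    have a1 := mul_le_mul_of_nonneg_left hlogM (by positivity : 0 ≤ 4 * (1 + τ))
    have a2 : 1 ≤ (1 + τ) * ℓ := one_le_mul_of_one_le_of_one_le (by linarith) hlog
    linarith
  have hℓ : 0 ≤ ℓ := by linarith
  have h2 : κ * ε ^ 2 * ((1 + τ) * ε) ≤
      γ * (1 + 19 * β ^ 2 * Δ) * ((1 + 23 * β * √Ω) * (√Lxx + Lxy)) :=
    mul_le_mul hκb hτb (by positivity) (by positivity)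
  calc κ * (4 * (1 + τ) * Real.log M + 1) ≤ κ * (40 * ((1 + τ) * ℓ)) :=
        mul_le_mul_of_nonneg_left h1 hκ0.le
    _ = κ * ε ^ 2 * ((1 + τ) * ε) * (40 * (1 / ε) ^ 3 * ℓ) := by field_simp
    _ ≤ γ * (1 + 19 * β ^ 2 * Δ) * ((1 + 23 * β * √Ω) * (√Lxx + Lxy)) *
        (40 * (1 / ε) ^ 3 * ℓ) := mul_le_mul_of_nonneg_right h2 (by positivity)
    _ = _ := by ring

end

/-- The hidden constant `C` depends only on bounds for `β`, `Ω` and `q(x₁) - q^*`; the threshold `ε₀`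
below which the complexity bound holds depends in addition only on `γ`, `L_xx`, `L_xy` and `R`. -/
theorem mainTheorem2 (β Ωbar Δ : ℝ) :
    ∃ C : ℝ, 0 < C ∧ ∀ γ Lxx Lxy R : ℝ, ∃ ε₀ : ℝ, 0 < ε₀ ∧
      ∀ (X : Type*) [NormedAddCommGroup X] [NormedSpace ℝ X] [FiniteDimensional ℝ X]
        (Y : Type*) [NormedAddCommGroup Y] [NormedSpace ℝ Y] [FiniteDimensional ℝ Y]
        (P : MinimaxProblem X Y) (c : Constants),
        c = ⟨γ, Lxx, Lxy, β⟩ → P.Assumptions c → P.Omega ≤ Ωbar →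
        ∀ ε : ℝ, 0 < ε →
        ∀ (A : X → ℝ → Y) (δ : ℝ), P.IsDualOracle (P.rho c ε) A → P.IsOracleAccuracy c ε δ →
          -- Step 2 is always completed after finitely many iterations of the inner method
          (∀ z ∈ relDom P.ωX P.𝒳, ∀ u₀ ∈ relDom P.ωX P.𝒳, ∃ n, P.IsStepTwoCount c ε A δ z u₀ n) ∧
          -- the algorithm stops, with a near-stationary point, within the claimed number of calls
          (∀ (x u : ℕ → X) (N : ℕ → ℕ), P.IsRun c ε A δ R x u N → P.q (x 1) - P.qStar ≤ Δ →
            ∃ K, 1 ≤ K ∧ c.Stops ε x K ∧ (∀ k, 1 ≤ k → k < K → ¬ c.Stops ε x k) ∧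
              P.IsNearStationary c.β ε c.lam (x K) ∧
              (ε ≤ ε₀ →
                (P.totalCalls c ε A δ x u N K : ℝ) ≤
                  C * (γ * (√Lxx + Lxy) * (1 / ε) ^ 3 * Real.log (1 / ε)))) := by
  -- The constant is fixed before any assumption is available; the absolute values keep it positive
  -- for arbitrary real parameters.
  refine ⟨40 * (1 + 19 * β ^ 2 * |Δ|) * (1 + 23 * |β| * √Ωbar), by positivity,
    fun γ Lxx Lxy R => ?_⟩
  obtain ⟨ε₀, hε₀, hbound⟩ : ∃ ε₀ : ℝ, 0 < ε₀ ∧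
      (1 ≤ β → 0 < Ωbar → 0 ≤ Δ → 0 < γ → γ ≤ Lxx → 0 ≤ Lxy →
      ∀ ε η κ L : ℝ, 0 < ε → ε ≤ ε₀ → η = ε ^ 2 / (128 * γ * β ^ 2) →
      κ = 2 + Δ / (7 * η) → L = Lxx + 2 * γ * β + Lxy ^ 2 * (4 * Ωbar / η) →
      κ * (4 * (1 + √(L / γ)) * Real.log (12 * ((γ * β / 2 + L) *
        (|R| + κ * √((Δ + 2 * η) / γ)) ^ 2) / η + 2 + 4 * L / γ) + 1) ≤
      40 * (1 + 19 * β ^ 2 * Δ) * (1 + 23 * β * √Ωbar) *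
        (γ * (√Lxx + Lxy) * (1 / ε) ^ 3 * Real.log (1 / ε))) := by
    -- The threshold must also precede the problem data. For inadmissible parameters any value
    -- serves, since no instance with such a run can satisfy the assumptions.
    by_cases hc : 1 ≤ β ∧ 0 < Ωbar ∧ 0 ≤ Δ ∧ 0 < γ ∧ γ ≤ Lxx ∧ 0 ≤ Lxy
    · obtain ⟨h1, h2, h3, h4, h5, h6⟩ := hc
      obtain ⟨ε₀, hε₀, h⟩ := complexity_bound R h1 h2 h3 h4 h5 h6
      exact ⟨ε₀, hε₀, fun _ _ _ _ _ _ => h⟩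
    · exact ⟨1, one_pos, fun h1 h2 h3 h4 h5 h6 => absurd ⟨h1, h2, h3, h4, h5, h6⟩ hc⟩
  refine ⟨ε₀, hε₀, ?_⟩
  intro X _ _ _ Y _ _ _ P c hc H hΩ ε hε A δ hA hδ
  refine ⟨fun z _ u₀ hu₀ => H.exists_isStepTwoCount hε hA hδ z hu₀.1, ?_⟩
  intro x u N hrun hΔ
  obtain ⟨K, hK, hterm, hns⟩ := H.exists_first_termination hε hrun
  refine ⟨K, hK, hterm, hns, H.isNearStationary_of_stepTwo hε
    (MinimaxProblem.Assumptions.run_mem hrun hK)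
    (MinimaxProblem.Assumptions.run_stepTwo hrun hK) hterm, fun hεε₀ => ?_⟩
  have hx1 := MinimaxProblem.Assumptions.run_mem hrun le_rfl
  have hΔ0 : 0 ≤ Δ := (sub_nonneg.2 (H.qStar_le hx1)).trans hΔ
  have hΩ0 := H.Omega_pos
  have hη0 := H.acc_pos hε
  have hβ1 := H.one_le_β
  have hγ0 := H.γ_pos
  have hγL := H.γ_le
  have hxy := H.Lxy_nonneg
  have hη : c.acc ε = ε ^ 2 / (128 * c.γ * c.β ^ 2) := by
    rw [Constants.acc, Constants.lam]; field_simp; norm_num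
  have hL : c.Lrho (P.rho c ε) ≤ Lxx + 2 * γ * β + Lxy ^ 2 * (4 * Ωbar / c.acc ε) := by
    have h1 : c.Lxy ^ 2 / P.rho c ε ≤ c.Lxy ^ 2 * (4 * Ωbar / c.acc ε) := by
      rw [MinimaxProblem.rho, div_div_eq_mul_div, mul_div_assoc]
      gcongr
    rw [Constants.Lrho, Constants.lam_inv]
    subst hc
    exact add_le_add_right h1 _
  have hcalls := H.totalCalls_le hε hA hδ hrun hΔ hK hns le_rfl hL
  subst hc
  rw [abs_of_nonneg hΔ0, abs_of_pos (one_pos.trans_le hβ1)]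
  exact hcalls.trans (hbound hβ1 (hΩ0.trans_le hΩ) hΔ0 hγ0 hγL hxy ε _ _ _ hε hεε₀ hη rfl rfl)
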